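/- Let $\mathbb T^2=\mathbb R^2/\mathbb Z^2$ with coordinates $(s,t)$, oriented by $ds\wedge dt$, and let $[\mathbb T^2]\in H_2(\mathbb T^2,\mathbb Z)$ be the corresponding fundamental class in singular homology. Let $\mathcal E$ be a (topological, locally trivial) complex vector bundle of rank $q\ge 0$ on $\mathbb T^2$, and let $c_1(\mathcal E)\in H^2(\mathbb T^2,\mathbb Z)$ be its first Chern class, i.e. the Euler class of the determinant line bundle $\bigwedge^q\mathcal E$ with its complex orientation (the restriction to the zero section of the Thom class of $\bigwedge^q\mathcal E$). Rieffel's twist $\mathrm{tw}(\mathcal E)\in\mathbb Z$ is defined as follows. Equip $\mathcal E$ with a continuous Hermitian metric (one exists). Regard $\mathbb T^2$ as $\mathbb S^1\times[0,1]$, $\mathbb S^1=\mathbb R/\mathbb Z$, with the boundary circles $\mathbb S^1\times\{0\}$ and $\mathbb S^1\times\{1\}$ glued by $(s,0)\sim(s,1)$, and choose a unitary trivialization $\Phi_{(s,t)}:\mathbb C^q\to\mathcal E_{(s,t)}$ over $\mathbb S^1\times[0,1]$ of the pulled-back bundle (one exists). Let $g:\mathbb S^1\to U(q)$ be the clutching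 map, defined by $\Phi_{(s,0)}(v)=\Phi_{(s,1)}(g(s)v)$ for all $s\in\mathbb S^1$, $v\in\mathbb C^q$. Then $\mathrm{tw}(\mathcal E)$ is the image of the class of $g$ under $\pi_1(\det):\pi_1(U(q))\to\pi_1(\mathbb S^1)\cong\mathbb Z$, i.e. the degree of the loop $\det g:\mathbb R/\mathbb Z\to U(1)$. Then a twist and a first Chern class as above exist, and for every choice of the Hermitian metric and of the trivialization $$\mathrm{tw}(\mathcal E)=-\langle c_1(\mathcal E),[\mathbb T^2]\rangle .$$ -/

import Mathlib

open Bundle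

noncomputable section

namespace TorusBundle

/-! ### Singular homology and cohomology with integer coefficients, in positive degrees -/

section Singular

universe u v

/-- Singular `n`-simplices of `X`. -/
abbrev SingularSimplex (n : ℕ) (X : Type u) [TopologicalSpace X] : Type u :=
  C(stdSimplex ℝ (Fin (n + 1)), X)

/-- Singular `n`-chains: the free abelian group on the singular `n`-simplices. -/
abbrev Chain (n : ℕ) (X : Type u) [TopologicalSpace X] : Type u :=
  SingularSimplex n X →₀ ℤ

/-- Singular `n`-cochains: `Hom(C_n(X), ℤ)`. -/
abbrev Cochain (n : ℕ) (X : Type u) [TopologicalSpace X] : Type u :=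
  Chain n X →ₗ[ℤ] ℤ

variable {X : Type u} [TopologicalSpace X] {Y : Type v} [TopologicalSpace Y] {n : ℕ}

/-- The `i`-th face (the one opposite to the `i`-th vertex) of a singular simplex. -/
def face (i : Fin (n + 2)) (σ : SingularSimplex (n + 1) X) : SingularSimplex n X :=
  σ.comp ⟨stdSimplex.map i.succAbove, stdSimplex.continuous_map _⟩

/-- The boundary `∂σ = ∑ (-1)^i σ_i`, extended linearly. -/
def boundary (n : ℕ) (X : Type u) [TopologicalSpace X] : Chain (n + 1) X →ₗ[ℤ] Chain n X :=
  Finsupp.linearCombination ℤ fun σ : SingularSimplex (n + 1) X =>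
    ∑ i : Fin (n + 2), (-1 : ℤ) ^ (i : ℕ) • Finsupp.single (face i σ) (1 : ℤ)

/-- The coboundary `φ ↦ φ ∘ ∂`. -/
def coboundary (n : ℕ) (X : Type u) [TopologicalSpace X] : Cochain n X →ₗ[ℤ] Cochain (n + 1) X :=
  (boundary n X).lcomp ℤ ℤ

/-- Singular cycles of degree `n + 1`. -/
abbrev Cycles (n : ℕ) (X : Type u) [TopologicalSpace X] : Submodule ℤ (Chain (n + 1) X) :=
  LinearMap.ker (boundary n X)

/-- Singular cocycles of degree `n`. -/
abbrev Cocycles (n : ℕ) (X : Type u) [TopologicalSpace X] : Submodule ℤ (Cochain n X) :=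
  LinearMap.ker (coboundary n X)

/-- The singular homology group `H_{n+1}(X; ℤ)`. -/
abbrev Homology (n : ℕ) (X : Type u) [TopologicalSpace X] : Type u :=
  Cycles n X ⧸ (LinearMap.range (boundary (n + 1) X)).submoduleOf (Cycles n X)

/-- The singular cohomology group `H^{n+1}(X; ℤ)`. -/
abbrev Cohomology (n : ℕ) (X : Type u) [TopologicalSpace X] : Type u :=
  Cocycles (n + 1) X ⧸ (LinearMap.range (coboundary n X)).submoduleOf (Cocycles (n + 1) X)

/-- The Kronecker pairing `⟨[φ], [c]⟩ = φ(c)` of `H^{n+1}(X; ℤ)` with `H_{n+1}(X; ℤ)`. -/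
def kronecker (n : ℕ) (X : Type u) [TopologicalSpace X] :
    Cohomology n X →ₗ[ℤ] Homology n X →ₗ[ℤ] ℤ :=
  Submodule.liftQ _
    { toFun := fun φ => Submodule.liftQ _ (φ.1 ∘ₗ (Cycles n X).subtype) (by
        rintro ⟨c, hc⟩ ⟨d, hd⟩
        have h := LinearMap.congr_fun φ.2 d
        simp only [Submodule.subtype_apply] at hd
        subst hd
        exact h)
      map_add' := fun φ ψ => by
        refine Submodule.linearMap_qext _ (LinearMap.ext fun c => ?_)
        simp
      map_smul' := fun a φ => by
        refine Submodule.linearMap_qext _ (LinearMap.ext fun c => ?_)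
        simp }
    (by
      rintro ⟨φ, hφ⟩ ⟨ψ, hψ⟩
      refine Submodule.linearMap_qext _ (LinearMap.ext fun c => ?_)
      simp only [Submodule.subtype_apply] at hψ
      subst hψ
      have h : boundary n X c.1 = 0 := c.2
      simp [coboundary, h])

theorem kronecker_mk (φ : Cocycles (n + 1) X) (c : Cycles n X) :
    kronecker n X (Submodule.Quotient.mk φ) (Submodule.Quotient.mk c) = φ.1 c.1 := rfl

/-- The map induced on singular chains by a continuous map. -/
def chainMap (n : ℕ) (f : C(X, Y)) : Chain n X →ₗ[ℤ] Chain n Y :=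
  Finsupp.lmapDomain ℤ ℤ fun σ : SingularSimplex n X => f.comp σ

theorem boundary_chainMap (f : C(X, Y)) (c : Chain (n + 1) X) :
    boundary n Y (chainMap (n + 1) f c) = chainMap n f (boundary n X c) := by
  induction c using Finsupp.induction_linear with
  | zero => simp
  | add a b ha hb => simp only [map_add, ha, hb]
  | single σ a =>
    simp only [chainMap, boundary, Finsupp.lmapDomain_apply, Finsupp.mapDomain_single,
      Finsupp.linearCombination_single, map_smul, map_sum]
    rfl

/-- The pullback of singular cocycles along a continuous map. -/
def pullbackCocycle (n : ℕ) (f : C(X, Y)) (φ : Cocycles n Y) : Cocycles n X :=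
  ⟨φ.1 ∘ₗ chainMap n f, by
    refine LinearMap.ext fun c => ?_
    have h := LinearMap.congr_fun φ.2 (chainMap (n + 1) f c)
    simp only [coboundary, LinearMap.lcomp_apply, boundary_chainMap] at h ⊢
    exact h⟩

end Singular

/-! ### The torus and its fundamental class -/

/-- The torus `𝕋² = ℝ²/ℤ²`, with coordinates `(s, t)`. -/
abbrev Torus : Type := UnitAddCircle × UnitAddCircle

/-- The singular simplex of the torus which is the image of the affine simplex in `ℝ²` with
vertices `v 0, …, v n`. -/
def affineSimplex {n : ℕ} (v : Fin (n + 1) → ℝ × ℝ) : SingularSimplex n Torus where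
  toFun p := (((∑ i, p i * (v i).1 : ℝ) : UnitAddCircle), ((∑ i, p i * (v i).2 : ℝ) : UnitAddCircle))
  continuous_toFun := by
    have h (i : Fin (n + 1)) : Continuous fun p : stdSimplex ℝ (Fin (n + 1)) => p i :=
      (continuous_apply i).comp continuous_subtype_val
    refine Continuous.prodMk ?_ ?_ <;>
    · refine (AddCircle.continuous_mk' 1).comp ?_
      exact continuous_finsetSum _ fun i _ => (h i).mul continuous_const

theorem face_affineSimplex {n : ℕ} (v : Fin (n + 2) → ℝ × ℝ) (i : Fin (n + 2)) :
    face i (affineSimplex v) = affineSimplex (v ∘ i.succAbove) := by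
  have key (p : stdSimplex ℝ (Fin (n + 1))) (w : Fin (n + 2) → ℝ) :
      ∑ j, stdSimplex.map i.succAbove p j * w j = ∑ j, p j * w (i.succAbove j) := by
    simp_rw [stdSimplex.map_coe, FunOnFinite.linearMap_apply_apply]
    rw [Fin.sum_univ_succAbove _ i]
    have h1 : ∀ j : Fin (n + 1), i.succAbove j ≠ i := Fin.succAbove_ne i
    simp [h1, Finset.filter_eq']
  refine ContinuousMap.ext fun p => Prod.ext ?_ ?_
  · exact congrArg (fun x : ℝ => (x : UnitAddCircle)) (key p fun j => (v j).1)
  · exact congrArg (fun x : ℝ => (x : UnitAddCircle)) (key p fun j => (v j).2)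

/-- Translating the vertices by an integer vector does not change the simplex of the torus. -/
theorem affineSimplex_translate {n : ℕ} (v w : Fin (n + 1) → ℝ × ℝ) (a b : ℤ)
    (h : ∀ i, w i = v i + ((a : ℝ), (b : ℝ))) : affineSimplex w = affineSimplex v := by
  have key (p : stdSimplex ℝ (Fin (n + 1))) (x : Fin (n + 1) → ℝ) (m : ℤ) :
      ((∑ i, p i * (x i + m) : ℝ) : UnitAddCircle) = ((∑ i, p i * x i : ℝ) : UnitAddCircle) := by
    simp_rw [mul_add, Finset.sum_add_distrib, ← Finset.sum_mul, stdSimplex.sum_eq_one, one_mul]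
    rw [AddCircle.coe_add, add_eq_left, AddCircle.coe_eq_zero_iff]
    exact ⟨m, by simp⟩
  refine ContinuousMap.ext fun p => Prod.ext ?_ ?_
  · exact (congrArg _ (Finset.sum_congr rfl fun i _ => by rw [h]; rfl)).trans
      (key p (fun j => (v j).1) a)
  · exact (congrArg _ (Finset.sum_congr rfl fun i _ => by rw [h]; rfl)).trans
      (key p (fun j => (v j).2) b)

/-- `[(0,0), (1,0), (1,1)] - [(0,0), (0,1), (1,1)]`: the unit square cut along its diagonal. The
first triangle is positively oriented for `ds ∧ dt`, the second one negatively. -/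
def fundamentalChain : Chain 2 Torus :=
  Finsupp.single (affineSimplex ![(0, 0), (1, 0), (1, 1)]) 1
    - Finsupp.single (affineSimplex ![(0, 0), (0, 1), (1, 1)]) 1

theorem boundary_fundamentalChain : boundary 1 Torus fundamentalChain = 0 := by
  have h0 : affineSimplex (![((0 : ℝ), (0 : ℝ)), (1, 0), (1, 1)] ∘ (0 : Fin 3).succAbove)
      = affineSimplex (![((0 : ℝ), (0 : ℝ)), (0, 1), (1, 1)] ∘ (2 : Fin 3).succAbove) :=
    affineSimplex_translate _ _ 1 0 fun i => by
      fin_cases i <;> simp [Fin.succAbove]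
  have h1 : affineSimplex (![((0 : ℝ), (0 : ℝ)), (1, 0), (1, 1)] ∘ (1 : Fin 3).succAbove)
      = affineSimplex (![((0 : ℝ), (0 : ℝ)), (0, 1), (1, 1)] ∘ (1 : Fin 3).succAbove) :=
    affineSimplex_translate _ _ 0 0 fun i => by
      fin_cases i <;> simp [Fin.succAbove]
  have h2 : affineSimplex (![((0 : ℝ), (0 : ℝ)), (0, 1), (1, 1)] ∘ (0 : Fin 3).succAbove)
      = affineSimplex (![((0 : ℝ), (0 : ℝ)), (1, 0), (1, 1)] ∘ (2 : Fin 3).succAbove) :=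
    affineSimplex_translate _ _ 0 1 fun i => by
      fin_cases i <;> simp [Fin.succAbove]
  simp only [fundamentalChain, boundary, map_sub, Finsupp.linearCombination_single, one_smul,
    face_affineSimplex]
  rw [Fin.sum_univ_three, Fin.sum_univ_three, h0, h1, h2]
  simp only [Fin.val_zero, Fin.val_one, Fin.val_two, pow_zero, pow_one, one_smul]
  module

/-- The fundamental class `[𝕋²] ∈ H_2(𝕋²; ℤ)` of the torus oriented by `ds ∧ dt`. -/
def fundamentalClass : Homology 1 Torus :=
  Submodule.Quotient.mk ⟨fundamentalChain, boundary_fundamentalChain⟩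

/-! ### The first Chern class -/

section Chern

variable {B : Type*} [TopologicalSpace B]

/-- For a vector `w` in the fibre over `b` of a complex line bundle, the singular simplex
`Δ² → L_b ⊆ L` which is affine with vertices `w`, `ζ w`, `ζ² w`, where `ζ = exp (2πi/3)`. If `w ≠ 0`
it is an embedding into the fibre, preserves the complex orientation and sends the barycentre
to `0`, so it represents the preferred generator of `H_2(L_b, L_b ∖ 0; ℤ)`. -/
def fibreSimplex {L : B → Type*} [∀ b, AddCommGroup (L b)] [∀ b, Module ℂ (L b)]
    [∀ b, TopologicalSpace (L b)] [TopologicalSpace (TotalSpace ℂ L)] [FiberBundle ℂ L]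
    [VectorBundle ℂ ℂ L] (b : B) (w : L b) : SingularSimplex 2 (TotalSpace ℂ L) where
  toFun p := ⟨b, (∑ i : Fin 3, (p i : ℂ) * Complex.exp (2 * Real.pi * Complex.I / 3) ^ (i : ℕ)) • w⟩
  continuous_toFun := by
    have h (i : Fin 3) : Continuous fun p : stdSimplex ℝ (Fin 3) => p i :=
      (continuous_apply i).comp continuous_subtype_val
    have hs : Continuous fun z : ℂ => z • w := by
      have e := VectorBundle.continuousLinearEquivAt ℂ ℂ L b
      have : (fun z : ℂ => z • w) = fun z : ℂ => e.symm (z • e w) := by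
        funext z
        rw [map_smul, e.symm_apply_apply]
      rw [this]
      exact e.symm.continuous.comp (continuous_id.smul continuous_const)
    refine (FiberBundle.continuous_totalSpaceMk ℂ L b).comp (hs.comp ?_)
    exact continuous_finsetSum _ fun i _ =>
      (Complex.continuous_ofReal.comp (h i)).mul continuous_const

/-- `u` is a singular cocycle on the total space of the complex line bundle `L` which represents
the Thom class in `H²(L, L ∖ 0; ℤ)`: it vanishes on the simplices of the complement of the zero
section and takes the value `1` on the preferred generator of `H_2(L_b, L_b ∖ 0; ℤ)` for every
fibre. -/
structure IsThomCocycle (L : B → Type*) [∀ b, AddCommGroup (L b)] [∀ b, Module ℂ (L b)]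
    [∀ b, TopologicalSpace (L b)] [TopologicalSpace (TotalSpace ℂ L)] [FiberBundle ℂ L]
    [VectorBundle ℂ ℂ L] (u : Cocycles 2 (TotalSpace ℂ L)) : Prop where
  relative : ∀ σ : SingularSimplex 2 (TotalSpace ℂ L), (∀ p, (σ p).2 ≠ 0) →
    u.1 (Finsupp.single σ 1) = 0
  generator : ∀ (b : B) (w : L b), w ≠ 0 → u.1 (Finsupp.single (fibreSimplex b w) 1) = 1

/-- `c ∈ H²(B; ℤ)` is the first Chern class (the Euler class) of the complex line bundle `L`: the
restriction of the Thom class to the zero section. -/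
def IsFirstChernClassOfLine (L : B → Type*) [∀ b, AddCommGroup (L b)] [∀ b, Module ℂ (L b)]
    [∀ b, TopologicalSpace (L b)] [TopologicalSpace (TotalSpace ℂ L)] [FiberBundle ℂ L]
    [VectorBundle ℂ ℂ L] (c : Cohomology 1 B) : Prop :=
  ∃ u : Cocycles 2 (TotalSpace ℂ L), IsThomCocycle L u ∧
    c = Submodule.Quotient.mk
      (pullbackCocycle 2 ⟨zeroSection ℂ L, Bundle.Trivialization.continuous_zeroSection ℂ⟩ u)

variable {F : Type*} [NormedAddCommGroup F] [NormedSpace ℂ F] [FiniteDimensional ℂ F]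
  (E : B → Type*) [∀ b, AddCommGroup (E b)] [∀ b, Module ℂ (E b)] [∀ b, TopologicalSpace (E b)]
  [TopologicalSpace (TotalSpace F E)] [FiberBundle F E] [VectorBundle ℂ F E]

variable (F) in
/-- The determinant line bundle (top exterior power) of `E`: its transition functions are the
determinants of the transition functions of `E`. -/
def detCore :
    VectorBundleCore ℂ B ℂ {e : Trivialization F (π F E) // MemTrivializationAtlas e} where
  baseSet e := e.1.baseSet
  isOpen_baseSet e := e.1.open_baseSet
  indexAt b := ⟨trivializationAt F E b, inferInstance⟩
  mem_baseSet_at b := FiberBundle.mem_baseSet_trivializationAt F E b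
  coordChange e e' b :=
    haveI := e.2
    haveI := e'.2
    (e.1.coordChangeL ℂ e'.1 b : F →L[ℂ] F).det • ContinuousLinearMap.id ℂ ℂ
  coordChange_self := by
    rintro ⟨e, he⟩ b hb v
    have h : (e.coordChangeL ℂ e b : F →L[ℂ] F) = ContinuousLinearMap.id ℂ F := by
      ext x
      change e.coordChangeL ℂ e b x = x
      rw [e.coordChangeL_apply e ⟨hb, hb⟩, e.apply_mk_symm hb]
    simp [h, ContinuousLinearMap.det]
  continuousOn_coordChange := by
    rintro ⟨e, he⟩ ⟨e', he'⟩
    exact (ContinuousLinearMap.continuous_det.comp_continuousOn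
      (continuousOn_coordChange ℂ e e')).smul continuousOn_const
  coordChange_comp := by
    rintro ⟨e, he⟩ ⟨e', he'⟩ ⟨e'', he''⟩ b ⟨⟨hb, hb'⟩, hb''⟩ v
    have h : (e.coordChangeL ℂ e'' b : F →L[ℂ] F)
        = (e'.coordChangeL ℂ e'' b : F →L[ℂ] F).comp (e.coordChangeL ℂ e' b : F →L[ℂ] F) := by
      ext x
      change e.coordChangeL ℂ e'' b x = e'.coordChangeL ℂ e'' b (e.coordChangeL ℂ e' b x)
      rw [e.coordChangeL_apply e'' ⟨hb, hb''⟩, e'.coordChangeL_apply e'' ⟨hb', hb''⟩,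
        e.coordChangeL_apply e' ⟨hb, hb'⟩]
      have : e'.symm b (e' ⟨b, e.symm b x⟩).2 = e.symm b x :=
        e'.symm_apply_apply_mk hb' _
      rw [this]
    simp only [h, ContinuousLinearMap.det, ContinuousLinearMap.toLinearMap_comp,
      LinearMap.det_comp, smul_apply, ContinuousLinearMap.id_apply, smul_eq_mul,
      mul_assoc]

variable (F) in
/-- `c ∈ H²(B; ℤ)` is the first Chern class of the complex vector bundle `E`, i.e. that of its
determinant line bundle. -/
def IsFirstChernClass (c : Cohomology 1 B) : Prop :=
  IsFirstChernClassOfLine (detCore F E).Fiber c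

end Chern

/-! ### The twist -/

section Twist

/-- `f : ℝ/ℤ → U(1)` is a loop of degree `n`, i.e. its class in `π₁(U(1)) ≅ ℤ` is `n`. -/
def HasDegree (f : UnitAddCircle → ℂ) (n : ℤ) : Prop :=
  ∃ θ : ℝ → ℝ, Continuous θ ∧
    (∀ s : ℝ, f (s : UnitAddCircle) = Complex.exp (2 * Real.pi * Complex.I * (θ s : ℂ))) ∧
    θ 1 - θ 0 = n

/-- A continuous Hermitian metric on a complex vector bundle. -/
structure HermitianMetric {B : Type*} [TopologicalSpace B] (F : Type*) [NormedAddCommGroup F]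
    [NormedSpace ℂ F] (E : B → Type*) [∀ b, AddCommGroup (E b)] [∀ b, Module ℂ (E b)]
    [TopologicalSpace (TotalSpace F E)] where
  form : ∀ b, InnerProductSpace.Core ℂ (E b)
  continuous_form :
    Continuous fun p : TotalSpace (F × F) (E ×ᵇ E) => (form p.proj).inner p.snd.1 p.snd.2

/-- The map `S¹ × [0, 1] → 𝕋²` gluing the two boundary circles. -/
def glue (z : UnitAddCircle × unitInterval) : Torus := (z.1, ((z.2 : ℝ) : UnitAddCircle))

variable {q : ℕ} {E : Torus → Type*} [∀ x, AddCommGroup (E x)] [∀ x, Module ℂ (E x)]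
  [TopologicalSpace (TotalSpace (EuclideanSpace ℂ (Fin q)) E)]

/-- A unitary trivialization over `S¹ × [0, 1]` of the pullback of the Hermitian bundle `E`. -/
structure CylinderTrivialization (h : HermitianMetric (EuclideanSpace ℂ (Fin q)) E) where
  toFun : ∀ z : UnitAddCircle × unitInterval, EuclideanSpace ℂ (Fin q) ≃ₗ[ℂ] E (glue z)
  unitary : ∀ z v w, (h.form (glue z)).inner (toFun z v) (toFun z w) = inner ℂ v w
  continuous_toFun : Continuous
    fun p : (UnitAddCircle × unitInterval) × EuclideanSpace ℂ (Fin q) =>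
      (⟨glue p.1, toFun p.1 p.2⟩ : TotalSpace (EuclideanSpace ℂ (Fin q)) E)

/-- `g : S¹ → U(q)` is the clutching map of the trivialization `Φ`: it identifies the fibre over
`(s, 0)` with the fibre over `(s, 1)`, that is, `Φ (s, 0) v` and `Φ (s, 1) (g s v)` are the same
point of `E`. -/
def IsClutchingMap {h : HermitianMetric (EuclideanSpace ℂ (Fin q)) E}
    (Φ : CylinderTrivialization h) (g : C(UnitAddCircle, Matrix.unitaryGroup (Fin q) ℂ)) : Prop :=
  ∀ (s : UnitAddCircle) (v : EuclideanSpace ℂ (Fin q)),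
    (⟨glue (s, 0), Φ.toFun (s, 0) v⟩ : TotalSpace (EuclideanSpace ℂ (Fin q)) E) =
      ⟨glue (s, 1), Φ.toFun (s, 1) (Matrix.toEuclideanLin (g s).1 v)⟩

/-- `n` is the twist of the Hermitian bundle `(E, h)`: the image under
`π₁(det) : π₁(U(q)) → π₁(U(1)) ≅ ℤ` of the class of a clutching map. -/
def IsTwist (h : HermitianMetric (EuclideanSpace ℂ (Fin q)) E) (n : ℤ) : Prop :=
  ∃ (Φ : CylinderTrivialization h) (g : C(UnitAddCircle, Matrix.unitaryGroup (Fin q) ℂ)),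
    IsClutchingMap Φ g ∧ HasDegree (fun s => (g s).1.det) n

end Twist

end TorusBundle

end

/-! Everything is pulled back to ℝ² × ℂ. Let n be a twist, given by a trivialization Φ and a
clutching map g, and let θ be an angle function of det g, so that θ(s + 1) = θ(s) + n. The vectors
exp(2πi{t}θ(s)) · det Φ(s, {t}) form a nowhere zero section of the pullback of the determinant line
to ℝ². The clutching relation makes it continuous across integral t, and s ↦ s + a multiplies it by
exp(2πi n a t). Hence the determinant line is the quotient of ℝ² × ℂ by the maps `deck n a b`
(`exists_twistedFrame`).

A Thom cocycle pulls back to a 2-cocycle U on ℝ² × ℂ that is invariant under these maps, zero off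
the zero section and equal to 1 on a fibre triangle. These properties force its value on the unit
square to be -n (`cocycle_square_eq`). Since ℝ² × ℂ is acyclic, U = δβ, and the value on the square
is a difference of β on opposite edges. Moving these edges from the zero section to the unit section
leaves the difference unchanged. Off the zero section β is closed, hence after passing to logarithms
it is the coboundary of a function F that grows by 1 when the logarithm grows by 2πi. One edge of
the unit section acquires the phase exp(-2πi n t), and its logarithm ends at -2πi n. So
`kronecker_eq` holds for every twist and every Chern class, and neither uniqueness of the Thom class
nor independence of the choices is needed.

It remains to show existence. A Thom cocycle is obtained from an explicit invariant U
(`exists_invariant_cocycle`), which descends because simplices of the line bundle lift to ℝ² × ℂ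
uniquely up to `deck`. A metric comes from maps E → B × F → E built with a partition of unity
(`exists_splitting`). The same maps transport frames between nearby fibres, which trivializes E over
the cylinder (`hasFrame_glue`), and P^(-1/2), with P the Gram operator, makes the frame unitary
(`exists_unitary_frame`). -/

open Bundle

noncomputable section

namespace TorusBundle

/-! ### Cochains as functions on singular simplices -/

section Cochains

variable {X Y : Type*} [TopologicalSpace X] [TopologicalSpace Y] {n : ℕ}

/-- The coboundary of a function on singular simplices. -/
def delta (f : SingularSimplex n X → ℤ) (σ : SingularSimplex (n + 1) X) : ℤ :=
  ∑ i : Fin (n + 2), (-1 : ℤ) ^ (i : ℕ) * f (face i σ)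

theorem coboundary_single (φ : Cochain n X) (σ : SingularSimplex (n + 1) X) :
    coboundary n X φ (Finsupp.single σ 1) = delta (fun τ => φ (Finsupp.single τ 1)) σ := by
  simp only [coboundary, boundary, delta, LinearMap.lcomp_apply,
    Finsupp.linearCombination_single, one_smul, map_sum, map_smul, smul_eq_mul]

theorem delta_eq_zero_of_mem_cocycles {φ : Cochain n X} (hφ : φ ∈ Cocycles n X) :
    delta (fun τ => φ (Finsupp.single τ 1)) = 0 := by
  funext σ
  rw [← coboundary_single]
  exact LinearMap.congr_fun hφ _

/-- The cochain with prescribed values on singular simplices. -/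
def cochainOf (f : SingularSimplex n X → ℤ) : Cochain n X := Finsupp.linearCombination ℤ f

@[simp] theorem cochainOf_single (f : SingularSimplex n X → ℤ) (σ : SingularSimplex n X) :
    cochainOf f (Finsupp.single σ 1) = f σ := by
  simp [cochainOf]

theorem cochainOf_mem_cocycles {f : SingularSimplex n X → ℤ} (hf : delta f = 0) :
    cochainOf f ∈ Cocycles n X := by
  refine LinearMap.mem_ker.2 (Finsupp.lhom_ext' fun σ => LinearMap.ext_ring ?_)
  simpa [coboundary_single] using congrFun hf σ

theorem delta_comp (f : C(X, Y)) (φ : SingularSimplex n Y → ℤ) :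
    delta (fun σ : SingularSimplex n X => φ (f.comp σ)) = fun σ => delta φ (f.comp σ) := rfl

theorem delta_sub (f g : SingularSimplex n X → ℤ) :
    delta (fun σ => f σ - g σ) = fun σ => delta f σ - delta g σ := by
  funext σ
  simp [delta, mul_sub, Finset.sum_sub_distrib]

/-- The singular `0`-simplex at a point. -/
def pointSimplex (x : X) : SingularSimplex 0 X := ContinuousMap.const _ x

theorem simplex_zero_eq (σ : SingularSimplex 0 X) (p : stdSimplex ℝ (Fin 1)) :
    σ = pointSimplex (σ p) := by
  ext x
  exact congrArg σ (Subsingleton.elim _ _)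

theorem face_zero_path (γ : SingularSimplex 1 X) :
    face 0 γ = pointSimplex (γ (stdSimplex.vertex 1)) := by
  rw [simplex_zero_eq (face 0 γ) (stdSimplex.vertex 0)]
  simp [face]

theorem face_one_path (γ : SingularSimplex 1 X) :
    face 1 γ = pointSimplex (γ (stdSimplex.vertex 0)) := by
  rw [simplex_zero_eq (face 1 γ) (stdSimplex.vertex 0)]
  simp [face]

theorem delta_zero_apply (f : SingularSimplex 0 X → ℤ) (γ : SingularSimplex 1 X) :
    delta f γ = f (pointSimplex (γ (stdSimplex.vertex 1)))
      - f (pointSimplex (γ (stdSimplex.vertex 0))) := by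
  simp [delta, Fin.sum_univ_two, face_zero_path, face_one_path, sub_eq_add_neg]

theorem delta_one_apply (f : SingularSimplex 1 X → ℤ) (σ : SingularSimplex 2 X) :
    delta f σ = f (face 0 σ) - f (face 1 σ) + f (face 2 σ) := by
  simp [delta, Fin.sum_univ_three, sub_eq_add_neg]

end Cochains

/-! ### Affine simplices and cones -/

theorem map_succAbove_self {n : ℕ} (i : Fin (n + 2)) (p : stdSimplex ℝ (Fin (n + 1))) :
    stdSimplex.map i.succAbove p i = 0 := by
  rw [stdSimplex.map_coe, FunOnFinite.linearMap_apply_apply]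
  simp [Fin.succAbove_ne]

theorem map_succAbove_succAbove {n : ℕ} (i : Fin (n + 2)) (p : stdSimplex ℝ (Fin (n + 1)))
    (j : Fin (n + 1)) : stdSimplex.map i.succAbove p (i.succAbove j) = p j := by
  rw [stdSimplex.map_coe, FunOnFinite.linearMap_apply_apply]
  simp [Finset.filter_eq']

theorem continuous_coord {n : ℕ} (i : Fin n) : Continuous fun p : stdSimplex ℝ (Fin n) => p i :=
  (continuous_apply i).comp continuous_subtype_val

section Cone

variable {V : Type*} [NormedAddCommGroup V] [NormedSpace ℝ V] {n : ℕ}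

/-- The affine singular simplex with given vertices in a real normed space. -/
def affineMapSimplex (v : Fin (n + 1) → V) : SingularSimplex n V where
  toFun p := ∑ i, p i • v i
  continuous_toFun := continuous_finsetSum _ fun i _ => (continuous_coord i).smul continuous_const

theorem affineMapSimplex_apply (v : Fin (n + 1) → V) (p : stdSimplex ℝ (Fin (n + 1))) :
    affineMapSimplex v p = ∑ i, p i • v i := rfl

theorem affineMapSimplex_vertex (v : Fin (n + 1) → V) (i : Fin (n + 1)) :
    affineMapSimplex v (stdSimplex.vertex i) = v i := by
  simp [affineMapSimplex_apply, Pi.single_apply]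

theorem face_affineMapSimplex (v : Fin (n + 2) → V) (i : Fin (n + 2)) :
    face i (affineMapSimplex v) = affineMapSimplex (v ∘ i.succAbove) := by
  ext p
  change ∑ j, stdSimplex.map i.succAbove p j • v j = ∑ j, p j • v (i.succAbove j)
  rw [Fin.sum_univ_succAbove _ i]
  simp [map_succAbove_self, map_succAbove_succAbove]

/-- The radial projection of a standard simplex onto the face opposite to the vertex `0`. -/
def coneProj (p : stdSimplex ℝ (Fin (n + 2))) : stdSimplex ℝ (Fin (n + 1)) :=
  -- At the apex any point of the simplex would do as a default value, because `cone` multiplies by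
  -- `1 - p 0 = 0` there.
  ⟨fun i => if p 0 < 1 then p i.succ / (1 - p 0) else (Pi.single 0 1 : Fin (n + 1) → ℝ) i, by
    by_cases h : p 0 < 1
    · simp only [h, if_true]
      refine ⟨fun i => div_nonneg (stdSimplex.zero_le p _) (by linarith), ?_⟩
      have h1 := stdSimplex.sum_eq_one p
      rw [Fin.sum_univ_succ] at h1
      rw [← Finset.sum_div, div_eq_one_iff_eq (by linarith)]
      linarith
    · simp only [h, if_false]
      exact single_mem_stdSimplex ℝ (0 : Fin (n + 1))⟩

theorem coneProj_apply {p : stdSimplex ℝ (Fin (n + 2))} (h : p 0 < 1) (i : Fin (n + 1)) :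
    coneProj p i = p i.succ / (1 - p 0) := by
  change (if p 0 < 1 then p i.succ / (1 - p 0) else (Pi.single 0 1 : Fin (n + 1) → ℝ) i) = _
  rw [if_pos h]

theorem continuousAt_coneProj {p : stdSimplex ℝ (Fin (n + 2))} (h : p 0 < 1) :
    ContinuousAt (coneProj (n := n)) p := by
  refine Topology.IsInducing.subtypeVal.continuousAt_iff.2 (continuousAt_pi.2 fun i => ?_)
  have h1 : ContinuousAt (fun p : stdSimplex ℝ (Fin (n + 2)) => p i.succ / (1 - p 0)) p :=
    (continuous_coord _).continuousAt.div
      (continuousAt_const.sub (continuous_coord _).continuousAt) (by linarith)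
  refine h1.congr ?_
  filter_upwards [(isOpen_lt (continuous_coord 0) continuous_const).mem_nhds h] with x hx
  exact (coneProj_apply hx i).symm

/-- The cone with apex `0` over a singular simplex of a real normed space. -/
def cone (σ : SingularSimplex n V) : SingularSimplex (n + 1) V where
  toFun p := (1 - p 0) • σ (coneProj p)
  continuous_toFun := by
    refine continuous_iff_continuousAt.2 fun p => ?_
    have h1 : Continuous fun p : stdSimplex ℝ (Fin (n + 2)) => 1 - p 0 :=
      continuous_const.sub (continuous_coord 0)
    rcases (stdSimplex.le_one p 0).lt_or_eq with h | h
    · exact h1.continuousAt.smul (σ.continuous.continuousAt.comp (continuousAt_coneProj h))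
    -- At the apex `coneProj` need not be continuous, but σ has bounded image and the factor `1 - p
    -- 0` tends to 0.
    · have h0 : (1 - p 0) • σ (coneProj p) = 0 := by simp [h]
      obtain ⟨C, hC⟩ := (isCompact_range σ.continuous).isBounded.exists_norm_le
      have h2 : Filter.Tendsto (fun p : stdSimplex ℝ (Fin (n + 2)) => 1 - p 0) (nhds p) (nhds 0) := by
        simpa [h] using h1.tendsto p
      rw [ContinuousAt, h0]
      exact h2.zero_smul_isBoundedUnder_le
        (Filter.isBoundedUnder_of ⟨C, fun x => hC _ ⟨_, rfl⟩⟩)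

theorem face_zero_cone (σ : SingularSimplex n V) : face 0 (cone σ) = σ := by
  ext p
  have h0 : stdSimplex.map (Fin.succAbove (0 : Fin (n + 2))) p 0 = 0 := map_succAbove_self 0 p
  change (1 - stdSimplex.map (Fin.succAbove (0 : Fin (n + 2))) p 0) •
    σ (coneProj (stdSimplex.map (Fin.succAbove (0 : Fin (n + 2))) p)) = σ p
  rw [h0, sub_zero, one_smul]
  congr 1
  refine stdSimplex.ext (funext fun i => ?_)
  refine (coneProj_apply (by rw [h0]; exact one_pos) i).trans ?_
  rw [h0, sub_zero, div_one]
  exact map_succAbove_succAbove 0 p i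

theorem face_succ_cone (σ : SingularSimplex (n + 1) V) (i : Fin (n + 2)) :
    face i.succ (cone σ) = cone (face i σ) := by
  ext p
  have h0 : stdSimplex.map (Fin.succAbove i.succ) p 0 = p 0 := by
    have := map_succAbove_succAbove i.succ p 0
    rwa [Fin.succ_succAbove_zero] at this
  change (1 - stdSimplex.map (Fin.succAbove i.succ) p 0) •
      σ (coneProj (stdSimplex.map (Fin.succAbove i.succ) p))
    = (1 - p 0) • σ (stdSimplex.map i.succAbove (coneProj p))
  rw [h0]
  rcases (stdSimplex.le_one p 0).lt_or_eq with h | h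
  · congr 2
    refine stdSimplex.ext (funext fun j => ?_)
    refine (coneProj_apply (by rwa [h0]) j).trans ?_
    rw [h0]
    rcases Fin.eq_self_or_eq_succAbove i j with rfl | ⟨k, rfl⟩
    · rw [map_succAbove_self, map_succAbove_self, zero_div]
    · rw [map_succAbove_succAbove, coneProj_apply h, ← Fin.succ_succAbove_succ,
        map_succAbove_succAbove]
  · simp [h]

/-- The singular cochain complex of a normed space is exact in positive degrees. -/
theorem exists_delta_eq (f : SingularSimplex (n + 1) V → ℤ) (hf : delta f = 0) :
    ∃ g : SingularSimplex n V → ℤ, delta g = f := by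
  -- The faces of a cone are its base and the cones over the faces of the base, so 0 = δf(cone σ) =
  -- f(σ) - δ(f ∘ cone)(σ).
  refine ⟨fun σ => f (cone σ), funext fun σ => ?_⟩
  have h := congrFun hf (cone σ)
  rw [delta, Fin.sum_univ_succ, face_zero_cone] at h
  simp only [face_succ_cone, Fin.val_succ, pow_succ, Fin.val_zero, pow_zero, one_mul,
    Pi.zero_apply, mul_neg, mul_one, neg_mul, Finset.sum_neg_distrib] at h
  rw [delta]
  linarith

theorem eq_of_delta_eq_zero {f : SingularSimplex 0 V → ℤ} (hf : delta f = 0) (x y : V) :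
    f (pointSimplex x) = f (pointSimplex y) := by
  have h := congrFun hf (affineMapSimplex ![y, x])
  rw [delta_zero_apply, affineMapSimplex_vertex, affineMapSimplex_vertex] at h
  simpa [sub_eq_zero] using h

end Cone

/-! ### Lifting through coverings -/

instance {n : ℕ} : ContractibleSpace (stdSimplex ℝ (Fin (n + 1))) :=
  (convex_stdSimplex ℝ _).contractibleSpace ⟨_, single_mem_stdSimplex ℝ 0⟩

instance {n : ℕ} : LocallyPathConnectedSpace (stdSimplex ℝ (Fin (n + 1))) :=
  (convex_stdSimplex ℝ _).locallyPathConnectedSpace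

section Lifting

variable {A : Type*} [TopologicalSpace A]

theorem exists_log [SimplyConnectedSpace A] [LocallyPathConnectedSpace A] (v : C(A, ℂ))
    (hv : ∀ x, v x ≠ 0) : ∃ l : C(A, ℂ), ∀ x, Complex.exp (l x) = v x := by
  obtain ⟨a⟩ : Nonempty A := inferInstance
  obtain ⟨l, ⟨-, hl⟩, -⟩ := Complex.isCoveringMapOn_exp.existsUnique_continuousMap_lifts v
    (a₀ := a) (e₀ := Complex.log (v a)) (Complex.exp_log (hv a)) hv
  exact ⟨l, fun x => congrFun hl x⟩

theorem exists_real_lift [SimplyConnectedSpace A] [LocallyPathConnectedSpace A]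
    (f : C(A, UnitAddCircle)) : ∃ l : C(A, ℝ), ∀ x, (l x : UnitAddCircle) = f x := by
  obtain ⟨a⟩ : Nonempty A := inferInstance
  obtain ⟨y, hy⟩ := QuotientAddGroup.mk_surjective (f a)
  obtain ⟨l, ⟨-, hl⟩, -⟩ := (AddCircle.isCoveringMap_coe (1 : ℝ)).existsUnique_continuousMap_lifts f
    a y hy
  exact ⟨l, fun x => congrFun hl x⟩

theorem exists_eq_int_of_continuous [PreconnectedSpace A] [Nonempty A] {f : A → ℝ}
    (hf : Continuous f) (h : ∀ x, ∃ k : ℤ, f x = k) : ∃ k : ℤ, ∀ x, f x = k := by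
  choose g hg using h
  have hg' : Continuous g := by
    rw [Int.isClosedEmbedding_coe_real.isEmbedding.continuous_iff]
    exact hf.congr hg
  obtain ⟨a⟩ : Nonempty A := inferInstance
  exact ⟨g a, fun x => by rw [hg, PreconnectedSpace.constant inferInstance hg' (x := x) (y := a)]⟩

theorem exists_int_of_coe_eq [PreconnectedSpace A] [Nonempty A] {f g : A → ℝ}
    (hf : Continuous f) (hg : Continuous g)
    (h : ∀ x, (f x : UnitAddCircle) = (g x : UnitAddCircle)) : ∃ k : ℤ, ∀ x, g x = f x + k := by
  obtain ⟨k, hk⟩ := exists_eq_int_of_continuous (hg.sub hf) fun x => by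
    have h1 : ((g x - f x : ℝ) : UnitAddCircle) = 0 := by simp [h x]
    obtain ⟨k, hk⟩ := (AddCircle.coe_eq_zero_iff _).1 h1
    exact ⟨k, by simpa using hk.symm⟩
  exact ⟨k, fun x => by linarith [show g x - f x = k from hk x]⟩

theorem exists_int_of_exp_eq [PreconnectedSpace A] [Nonempty A] {f g : A → ℂ}
    (hf : Continuous f) (hg : Continuous g) (h : ∀ x, Complex.exp (f x) = Complex.exp (g x)) :
    ∃ k : ℤ, ∀ x, g x = f x + k * (2 * Real.pi * Complex.I) := by
  have h1 (x : A) : ∃ k : ℤ, g x = f x + k * (2 * Real.pi * Complex.I) :=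
    Complex.exp_eq_exp_iff_exists_int.1 (h x).symm
  obtain ⟨k, hk⟩ := exists_eq_int_of_continuous (f := fun x => (g x - f x).im / (2 * Real.pi))
    ((Complex.continuous_im.comp (hg.sub hf)).div_const _) fun x => by
      obtain ⟨k, hk⟩ := h1 x
      refine ⟨k, ?_⟩
      rw [hk]
      have : Real.pi ≠ 0 := Real.pi_ne_zero
      simp [this]
  refine ⟨k, fun x => ?_⟩
  obtain ⟨k', hk'⟩ := h1 x
  have h2 := hk x
  have : Real.pi ≠ 0 := Real.pi_ne_zero
  rw [hk'] at h2
  have h3 : (k' : ℝ) = k := by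
    rw [← h2]
    simp [this]
  rw [hk', Int.cast_injective h3]

end Lifting

/-! ### Winding numbers in `ℝ² × ℂ` -/

open Complex in
/-- The deck transformation `(s, t, v) ↦ (s + a, t + b, exp (-2πi n a t) v)` of `ℝ² × ℂ`. -/
def deck (n a b : ℤ) : C((ℝ × ℝ) × ℂ, (ℝ × ℝ) × ℂ) where
  toFun x := ((x.1.1 + a, x.1.2 + b), exp (-(2 * Real.pi * I * (n * a * x.1.2))) * x.2)
  continuous_toFun := by fun_prop

open Complex in
theorem deck_apply (n a b : ℤ) (s t : ℝ) (v : ℂ) : deck n a b ((s, t), v) =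
    ((s + a, t + b), exp (-(2 * Real.pi * I * (n * a * t))) * v) := rfl

open Complex in
/-- The universal covering `(x, l) ↦ (x, exp l)` of the complement of the zero section. -/
def expMap : C((ℝ × ℝ) × ℂ, (ℝ × ℝ) × ℂ) where
  toFun x := (x.1, exp x.2)
  continuous_toFun := by fun_prop

/-- The imaginary part `p 1 * w.im` vanishes only at the endpoint 1, so the principal logarithm is
continuous along the whole chord. -/
theorem add_mul_mem_slitPlane {w : ℂ} (hw : w.im ≠ 0) (p : stdSimplex ℝ (Fin 2)) :
    (p 0 + p 1 * w : ℂ) ∈ Complex.slitPlane := by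
  rw [Complex.mem_slitPlane_iff]
  rcases eq_or_ne (p 1) 0 with h | h
  · have h1 := stdSimplex.add_eq_one p
    left
    simp [h] at h1 ⊢
    simp [h1]
  · right
    simp [h, hw]

/-- The logarithm of the chord from `1` to `w`. -/
def chordLog {w : ℂ} (hw : w.im ≠ 0) : C(stdSimplex ℝ (Fin 2), ℂ) where
  toFun p := Complex.log (p 0 + p 1 * w)
  continuous_toFun := by
    refine Continuous.clog ?_ (add_mul_mem_slitPlane hw)
    exact (Complex.continuous_ofReal.comp (continuous_coord _)).add
      ((Complex.continuous_ofReal.comp (continuous_coord _)).mul continuous_const)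

theorem exp_chordLog {w : ℂ} (hw : w.im ≠ 0) (p : stdSimplex ℝ (Fin 2)) :
    Complex.exp (chordLog hw p) = p 0 + p 1 * w :=
  Complex.exp_log (Complex.slitPlane_ne_zero (add_mul_mem_slitPlane hw p))

theorem chordLog_vertex_zero {w : ℂ} (hw : w.im ≠ 0) :
    chordLog hw (stdSimplex.vertex 0) = 0 := by
  change Complex.log _ = 0
  simp

theorem chordLog_vertex_one {w : ℂ} (hw : w.im ≠ 0) :
    chordLog hw (stdSimplex.vertex 1) = Complex.log w := by
  change Complex.log _ = _
  simp

/-- The primitive third root of unity `exp (2πi/3)`. -/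
def zeta : ℂ := Complex.exp (2 * Real.pi * Complex.I / 3)

theorem zeta_eq_exp : zeta = Complex.exp (((2 * Real.pi / 3 : ℝ) : ℂ) * Complex.I) := by
  rw [zeta]
  congr 1
  push_cast
  ring

theorem zeta_sq_eq_exp : zeta ^ 2 = Complex.exp (((-(2 * Real.pi / 3) : ℝ) : ℂ) * Complex.I) := by
  rw [zeta, ← Complex.exp_nat_mul, Complex.exp_eq_exp_iff_exists_int]
  refine ⟨1, ?_⟩
  push_cast
  ring

theorem log_zeta : Complex.log zeta = 2 * Real.pi * Complex.I / 3 := by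
  have := Real.pi_pos
  rw [zeta_eq_exp, Complex.log_exp] <;> simp <;> first | linarith | ring

/-- The principal argument of ζ² is -2π/3 and not 4π/3. The discrepancy of 2πi with 2 log ζ is the
single turn of the fibre triangle around 0. -/
theorem log_zeta_sq : Complex.log (zeta ^ 2) = -(2 * Real.pi * Complex.I / 3) := by
  have := Real.pi_pos
  rw [zeta_sq_eq_exp, Complex.log_exp] <;> simp <;> first | linarith | ring

theorem zeta_im_ne_zero : zeta.im ≠ 0 := by
  have := Real.pi_pos
  rw [zeta_eq_exp, Complex.exp_ofReal_mul_I_im]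
  exact (Real.sin_pos_of_pos_of_lt_pi (by linarith) (by linarith)).ne'

theorem zeta_sq_im_ne_zero : (zeta ^ 2).im ≠ 0 := by
  have := Real.pi_pos
  rw [zeta_sq_eq_exp, Complex.exp_ofReal_mul_I_im, Real.sin_neg, neg_ne_zero]
  exact (Real.sin_pos_of_pos_of_lt_pi (by linarith) (by linarith)).ne'

section Vec3
variable {α : Type*} (a b c : α)
theorem vec_comp_succAbove_zero : ![a, b, c] ∘ (0 : Fin 3).succAbove = ![b, c] := by
  funext i; fin_cases i <;> rfl
theorem vec_comp_succAbove_one : ![a, b, c] ∘ (1 : Fin 3).succAbove = ![a, c] := by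
  funext i; fin_cases i <;> rfl
theorem vec_comp_succAbove_two : ![a, b, c] ∘ (2 : Fin 3).succAbove = ![a, b] := by
  funext i; fin_cases i <;> rfl
end Vec3

theorem delta_affineMapSimplex {V : Type*} [NormedAddCommGroup V] [NormedSpace ℝ V]
    (f : SingularSimplex 1 V → ℤ) (a b c : V) :
    delta f (affineMapSimplex ![a, b, c]) = f (affineMapSimplex ![b, c])
      - f (affineMapSimplex ![a, c]) + f (affineMapSimplex ![a, b]) := by
  rw [delta_one_apply, face_affineMapSimplex, face_affineMapSimplex, face_affineMapSimplex,
    vec_comp_succAbove_zero, vec_comp_succAbove_one, vec_comp_succAbove_two]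

theorem affineMapSimplex_pair_apply {V : Type*} [NormedAddCommGroup V] [NormedSpace ℝ V]
    (a b : V) (p : stdSimplex ℝ (Fin 2)) : affineMapSimplex ![a, b] p = p 0 • a + p 1 • b := by
  rw [affineMapSimplex_apply, Fin.sum_univ_two]
  rfl

/-- The three edges of the fibre simplex with vertices `1`, `ζ`, `ζ²` lift to paths of logarithms. -/
theorem edge_one_zeta (x : ℝ × ℝ) : affineMapSimplex ![(x, (1 : ℂ)), (x, zeta)] =
    expMap.comp ((ContinuousMap.const _ x).prodMk (chordLog zeta_im_ne_zero)) := by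
  ext1 p
  have h := stdSimplex.add_eq_one p
  rw [affineMapSimplex_pair_apply]
  refine Prod.ext ?_ ?_
  · change p 0 • x + p 1 • x = x
    rw [← add_smul, h, one_smul]
  · refine Eq.trans ?_ (exp_chordLog zeta_im_ne_zero p).symm
    simp

theorem edge_one_zeta_sq (x : ℝ × ℝ) : affineMapSimplex ![(x, (1 : ℂ)), (x, zeta ^ 2)] =
    expMap.comp ((ContinuousMap.const _ x).prodMk (chordLog zeta_sq_im_ne_zero)) := by
  ext1 p
  have h := stdSimplex.add_eq_one p
  rw [affineMapSimplex_pair_apply]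
  refine Prod.ext ?_ ?_
  · change p 0 • x + p 1 • x = x
    rw [← add_smul, h, one_smul]
  · refine Eq.trans ?_ (exp_chordLog zeta_sq_im_ne_zero p).symm
    simp

/-- This edge is the edge from 1 to ζ rotated by ζ, so its logarithm is shifted by 2πi/3 and runs on
to 4πi/3. -/
theorem edge_zeta_zeta_sq (x : ℝ × ℝ) : affineMapSimplex ![(x, zeta), (x, zeta ^ 2)] =
    expMap.comp ((ContinuousMap.const _ x).prodMk
      (chordLog zeta_im_ne_zero + ContinuousMap.const _ (2 * Real.pi * Complex.I / 3))) := by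
  ext1 p
  have h := stdSimplex.add_eq_one p
  rw [affineMapSimplex_pair_apply]
  refine Prod.ext ?_ ?_
  · change p 0 • x + p 1 • x = x
    rw [← add_smul, h, one_smul]
  · change p 0 • zeta + p 1 • zeta ^ 2 =
      Complex.exp (chordLog zeta_im_ne_zero p + 2 * Real.pi * Complex.I / 3)
    rw [Complex.exp_add, exp_chordLog, ← zeta]
    simp
    ring

/-- The evaluation on the unit square of a `2`-cocycle on `ℝ² × ℂ` which is invariant under the deck
transformations, vanishes on the complement of the zero section and is normalized on a fibre. -/
theorem cocycle_square_eq (n : ℤ) (U : SingularSimplex 2 ((ℝ × ℝ) × ℂ) → ℤ) (hU : delta U = 0)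
    (hdeck : ∀ a b σ, U ((deck n a b).comp σ) = U σ)
    (hrel : ∀ σ, (∀ p, (σ p).2 ≠ 0) → U σ = 0)
    (hgen : U (affineMapSimplex ![((0, 0), 1), ((0, 0), zeta), ((0, 0), zeta ^ 2)]) = 1) :
    U (affineMapSimplex ![((0, 0), 0), ((1, 0), 0), ((1, 1), 0)])
      - U (affineMapSimplex ![((0, 0), 0), ((0, 1), 0), ((1, 1), 0)]) = -n := by
  obtain ⟨β, rfl⟩ := exists_delta_eq U hU
  -- Since δβ is invariant, the translate of β minus β is closed, hence the coboundary of a function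
  -- h of points.
  have hh (a b : ℤ) : ∃ h : (ℝ × ℝ) × ℂ → ℤ, ∀ γ : SingularSimplex 1 ((ℝ × ℝ) × ℂ),
      β ((deck n a b).comp γ) - β γ
        = h (γ (stdSimplex.vertex 1)) - h (γ (stdSimplex.vertex 0)) := by
    obtain ⟨h, hh⟩ := exists_delta_eq (fun γ => β ((deck n a b).comp γ) - β γ) (by
      rw [delta_sub, delta_comp]
      exact funext fun σ => sub_eq_zero.2 (hdeck a b σ))
    exact ⟨fun x => h (pointSimplex x), fun γ => by
      rw [← delta_zero_apply, hh]⟩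
  obtain ⟨h₁, hh₁⟩ := hh 1 0
  obtain ⟨h₂, hh₂⟩ := hh 0 1
  -- δβ vanishes on the image of `expMap`, so the pullback of β to the space of logarithms is
  -- closed, hence exact.
  obtain ⟨F', hF'⟩ := exists_delta_eq (fun γ => β (expMap.comp γ)) (by
    rw [delta_comp]
    exact funext fun σ => hrel _ fun p => Complex.exp_ne_zero _)
  let F : (ℝ × ℝ) × ℂ → ℤ := fun x => F' (pointSimplex x)
  have hF (γ : SingularSimplex 1 ((ℝ × ℝ) × ℂ)) : β (expMap.comp γ)
      = F (γ (stdSimplex.vertex 1)) - F (γ (stdSimplex.vertex 0)) := by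
    rw [← delta_zero_apply, hF']
  -- the period of `F`
  have hper (k : ℤ) (x y : (ℝ × ℝ) × ℂ) :
      F (x.1, x.2 + k * (2 * Real.pi * Complex.I)) - F x
        = F (y.1, y.2 + k * (2 * Real.pi * Complex.I)) - F y := by
    let T : C((ℝ × ℝ) × ℂ, (ℝ × ℝ) × ℂ) :=
      ⟨fun x => (x.1, x.2 + k * (2 * Real.pi * Complex.I)), by fun_prop⟩
    have hT : expMap.comp T = expMap := by
      ext1 x
      exact Prod.ext rfl (Complex.exp_eq_exp_iff_exists_int.2 ⟨k, rfl⟩)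
    have := eq_of_delta_eq_zero (f := fun σ => F' (T.comp σ) - F' σ) (by
      rw [delta_sub, delta_comp, hF']
      refine funext fun σ => sub_eq_zero.2 ?_
      change β ((expMap.comp T).comp σ) = _
      rw [hT]) x y
    exact this
  -- The edges of the fibre triangle contribute F(4πi/3) - F(-2πi/3), an increment over exactly one
  -- period. The normalization of U says that it is 1.
  have hone : F ((0, 0), 0 + (1 : ℤ) * (2 * Real.pi * Complex.I)) - F ((0, 0), 0) = 1 := by
    rw [delta_affineMapSimplex, edge_one_zeta, edge_one_zeta_sq, edge_zeta_zeta_sq, hF, hF, hF] at hgen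
    let c := chordLog zeta_im_ne_zero
    let c' := chordLog zeta_sq_im_ne_zero
    let w := 2 * Real.pi * Complex.I / 3
    change F ((0, 0), c (stdSimplex.vertex 1) + w) - F ((0, 0), c (stdSimplex.vertex 0) + w)
      - (F ((0, 0), c' (stdSimplex.vertex 1)) - F ((0, 0), c' (stdSimplex.vertex 0)))
      + (F ((0, 0), c (stdSimplex.vertex 1)) - F ((0, 0), c (stdSimplex.vertex 0))) = 1 at hgen
    simp only [c, c', w, chordLog_vertex_zero, chordLog_vertex_one, log_zeta, log_zeta_sq] at hgen
    have h := hper 1 ((0, 0), 0) ((0, 0), -(2 * Real.pi * Complex.I / 3))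
    have e : -(2 * Real.pi * Complex.I / 3) + (1 : ℤ) * (2 * Real.pi * Complex.I)
      = 2 * Real.pi * Complex.I / 3 + 2 * Real.pi * Complex.I / 3 := by push_cast; ring
    simp only [e, zero_add] at h hgen ⊢
    linarith
  have hnat (k : ℤ) (x : ℝ × ℝ) : F (x, k * (2 * Real.pi * Complex.I)) - F (x, 0) = k := by
    have hstep (k : ℤ) : F (x, (k + 1 : ℤ) * (2 * Real.pi * Complex.I))
        = F (x, k * (2 * Real.pi * Complex.I)) + 1 := by
      have := hper 1 (x, k * (2 * Real.pi * Complex.I)) ((0, 0), 0)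
      have e : k * (2 * Real.pi * Complex.I) + (1 : ℤ) * (2 * Real.pi * Complex.I)
        = (k + 1 : ℤ) * (2 * Real.pi * Complex.I) := by push_cast; ring
      simp only [e] at this
      linarith
    induction k using Int.induction_on with
    | zero => simp
    | succ k ih => rw [hstep]; linarith
    | pred k ih =>
      have := hstep (-k - 1)
      rw [show (-(k : ℤ) - 1 + 1) = -k by ring] at this
      linarith
  -- edges in the zero section
  have e₁ : affineMapSimplex ![((1, 0), 0), ((1, 1), 0)]
      = (deck n 1 0).comp (affineMapSimplex ![((0, 0), (0 : ℂ)), ((0, 1), 0)]) := by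
    ext1 p
    have h := stdSimplex.add_eq_one p
    simp [affineMapSimplex_pair_apply, deck_apply, h]
  have e₂ : affineMapSimplex ![((0, 1), 0), ((1, 1), 0)]
      = (deck n 0 1).comp (affineMapSimplex ![((0, 0), (0 : ℂ)), ((1, 0), 0)]) := by
    ext1 p
    have h := stdSimplex.add_eq_one p
    simp [affineMapSimplex_pair_apply, deck_apply, h]
  -- paths from the zero section to the unit section
  have hexp : Complex.exp (-(2 * Real.pi * Complex.I * n)) = 1 :=
    Complex.exp_eq_one_iff.2 ⟨-n, by push_cast; ring⟩
  have r₁ : affineMapSimplex ![((1, 0), (0 : ℂ)), ((1, 0), 1)]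
      = (deck n 1 0).comp (affineMapSimplex ![((0, 0), (0 : ℂ)), ((0, 0), 1)]) := by
    ext1 p
    have h := stdSimplex.add_eq_one p
    simp [affineMapSimplex_pair_apply, deck_apply, h]
  -- Here the deck phase is exp(-2πi n), so integrality of n is what keeps the endpoint at 1.
  have r₂ : affineMapSimplex ![((1, 1), (0 : ℂ)), ((1, 1), 1)]
      = (deck n 1 0).comp (affineMapSimplex ![((0, 1), (0 : ℂ)), ((0, 1), 1)]) := by
    ext1 p
    have h := stdSimplex.add_eq_one p
    have h' : (p 0 + p 1 : ℂ) = 1 := by exact_mod_cast h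
    simp [affineMapSimplex_pair_apply, deck_apply, h, hexp]
  have r₃ : affineMapSimplex ![((0, 1), (0 : ℂ)), ((0, 1), 1)]
      = (deck n 0 1).comp (affineMapSimplex ![((0, 0), (0 : ℂ)), ((0, 0), 1)]) := by
    ext1 p
    have h := stdSimplex.add_eq_one p
    simp [affineMapSimplex_pair_apply, deck_apply, h]
  have r₄ : affineMapSimplex ![((1, 1), (0 : ℂ)), ((1, 1), 1)]
      = (deck n 0 1).comp (affineMapSimplex ![((1, 0), (0 : ℂ)), ((1, 0), 1)]) := by
    ext1 p
    have h := stdSimplex.add_eq_one p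
    simp [affineMapSimplex_pair_apply, deck_apply, h]
  -- edges in the unit section
  have l₁ : affineMapSimplex ![((0, 0), (1 : ℂ)), ((0, 1), 1)]
      = expMap.comp (affineMapSimplex ![((0, 0), (0 : ℂ)), ((0, 1), 0)]) := by
    ext1 p
    have h := stdSimplex.add_eq_one p
    have h' : (p 0 + p 1 : ℂ) = 1 := by exact_mod_cast h
    simp [affineMapSimplex_pair_apply, expMap, h']
  have l₂ : affineMapSimplex ![((0, 0), (1 : ℂ)), ((1, 0), 1)]
      = expMap.comp (affineMapSimplex ![((0, 0), (0 : ℂ)), ((1, 0), 0)]) := by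
    ext1 p
    have h := stdSimplex.add_eq_one p
    have h' : (p 0 + p 1 : ℂ) = 1 := by exact_mod_cast h
    simp [affineMapSimplex_pair_apply, expMap, h']
  -- The twist enters here: along this edge the fibre coordinate is exp(-2πi n t), whose logarithm
  -- runs linearly from 0 to -2πi n. The other edges of the unit section have constant logarithm 0.
  have l₃ : (deck n 1 0).comp (affineMapSimplex ![((0, 0), (1 : ℂ)), ((0, 1), 1)])
      = expMap.comp (affineMapSimplex ![((1, 0), (0 : ℂ)),
          ((1, 1), (-n : ℤ) * (2 * Real.pi * Complex.I))]) := by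
    ext1 p
    have h := stdSimplex.add_eq_one p
    have h' : (p 0 + p 1 : ℂ) = 1 := by exact_mod_cast h
    simp [affineMapSimplex_pair_apply, deck_apply, expMap, h, h']
    ring_nf
  have l₄ : (deck n 0 1).comp (affineMapSimplex ![((0, 0), (1 : ℂ)), ((1, 0), 1)])
      = expMap.comp (affineMapSimplex ![((0, 1), (0 : ℂ)), ((1, 1), 0)]) := by
    ext1 p
    have h := stdSimplex.add_eq_one p
    have h' : (p 0 + p 1 : ℂ) = 1 := by exact_mod_cast h
    simp [affineMapSimplex_pair_apply, deck_apply, expMap, h, h']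
  have q₁ := hh₁ (affineMapSimplex ![((0, 0), (0 : ℂ)), ((0, 1), 0)])
  have q₂ := hh₂ (affineMapSimplex ![((0, 0), (0 : ℂ)), ((1, 0), 0)])
  have q₃ := hh₁ (affineMapSimplex ![((0, 0), (0 : ℂ)), ((0, 0), 1)])
  have q₄ := hh₁ (affineMapSimplex ![((0, 1), (0 : ℂ)), ((0, 1), 1)])
  have q₅ := hh₂ (affineMapSimplex ![((0, 0), (0 : ℂ)), ((0, 0), 1)])
  have q₆ := hh₂ (affineMapSimplex ![((1, 0), (0 : ℂ)), ((1, 0), 1)])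
  have q₇ := hh₁ (affineMapSimplex ![((0, 0), (1 : ℂ)), ((0, 1), 1)])
  have q₈ := hh₂ (affineMapSimplex ![((0, 0), (1 : ℂ)), ((1, 0), 1)])
  have q₉ := hnat (-n) (1, 1)
  rw [← e₁] at q₁
  rw [← e₂] at q₂
  rw [← r₁] at q₃
  rw [← r₂] at q₄
  rw [← r₃] at q₅
  rw [← r₄] at q₆
  rw [l₃, l₁, hF, hF] at q₇
  rw [l₄, l₂, hF, hF, ← l₂] at q₈
  rw [← l₁] at q₇
  simp only [affineMapSimplex_vertex, Matrix.cons_val_zero, Matrix.cons_val_one] at q₁ q₂ q₃ q₄ q₅ q₆ q₇ q₈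
  -- The diagonal cancels. By `q₁` and `q₂` the rest is a combination of h₁ and h₂ on the zero
  -- section. In `q₃`–`q₆` the four vertical paths cancel, so the same combination on the unit
  -- section has the same value. By `q₇` and `q₈` that is F((1,1), -2πi n) - F((1,1), 0), which is
  -- -n by `q₉`.
  rw [delta_affineMapSimplex, delta_affineMapSimplex]
  linarith

/-! ### An invariant cocycle on `ℝ² × ℂ` -/

theorem face_vertex {X : Type*} [TopologicalSpace X] {n : ℕ} (σ : SingularSimplex (n + 1) X)
    (i : Fin (n + 2)) (k : Fin (n + 1)) :
    face i σ (stdSimplex.vertex k) = σ (stdSimplex.vertex (i.succAbove k)) :=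
  congrArg σ (stdSimplex.map_vertex _ _)

theorem face_face {X : Type*} [TopologicalSpace X] (σ : SingularSimplex 3 X) {i j : Fin 3}
    (h : i ≤ j) : face i (face j.succ σ) = face j (face i.castSucc σ) := by
  ext1 p
  refine congrArg σ ?_
  change stdSimplex.map _ (stdSimplex.map _ p) = stdSimplex.map _ (stdSimplex.map _ p)
  rw [stdSimplex.map_comp_apply, stdSimplex.map_comp_apply]
  congr 1
  funext k
  revert i j k
  decide

theorem delta_two_apply {X : Type*} [TopologicalSpace X] (f : SingularSimplex 2 X → ℤ)
    (σ : SingularSimplex 3 X) :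
    delta f σ = f (face 0 σ) - f (face 1 σ) + f (face 2 σ) - f (face 3 σ) := by
  change ∑ i : Fin 4, (-1 : ℤ) ^ (i : ℕ) * f (face i σ) = _
  simp [Fin.sum_univ_four]
  ring

theorem delta_delta {X : Type*} [TopologicalSpace X] (f : SingularSimplex 1 X → ℤ) :
    delta (delta f) = 0 := by
  funext σ
  have h00 : face 0 (face 1 σ) = face 0 (face 0 σ) := face_face σ (i := 0) (j := 0) (by decide)
  have h01 : face 0 (face 2 σ) = face 1 (face 0 σ) := face_face σ (i := 0) (j := 1) (by decide)
  have h02 : face 0 (face 3 σ) = face 2 (face 0 σ) := face_face σ (i := 0) (j := 2) (by decide)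
  have h11 : face 1 (face 2 σ) = face 1 (face 1 σ) := face_face σ (i := 1) (j := 1) (by decide)
  have h12 : face 1 (face 3 σ) = face 2 (face 1 σ) := face_face σ (i := 1) (j := 2) (by decide)
  have h22 : face 2 (face 3 σ) = face 2 (face 2 σ) := face_face σ (i := 2) (j := 2) (by decide)
  rw [delta_two_apply, delta_one_apply, delta_one_apply, delta_one_apply, delta_one_apply,
    h00, h01, h02, h11, h12, h22, Pi.zero_apply]
  ring

/-- A (discontinuous) branch of the logarithm of the fibre coordinate of `ℝ² × ℂ`. -/
def logBranch (n : ℤ) (x : (ℝ × ℝ) × ℂ) : ℂ :=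
  -- The phase makes the argument of the logarithm invariant under `deck`. Subtracting it with the
  -- fractional part of t instead of t makes the branch invariant under t ↦ t + b. The two differ by
  -- an integral multiple of 2πi, so it is still a logarithm of the fibre coordinate.
  Complex.log (x.2 * Complex.exp (2 * Real.pi * Complex.I * (n * ⌊x.1.1⌋ * x.1.2)))
    - 2 * Real.pi * Complex.I * (n * ⌊x.1.1⌋ * Int.fract x.1.2)

theorem exp_logBranch (n : ℤ) {x : (ℝ × ℝ) × ℂ} (hx : x.2 ≠ 0) :
    Complex.exp (logBranch n x) = x.2 := by
  rw [logBranch, Complex.exp_sub, Complex.exp_log (mul_ne_zero hx (Complex.exp_ne_zero _)),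
    mul_div_assoc, ← Complex.exp_sub]
  refine mul_eq_left₀ hx |>.2 (Complex.exp_eq_one_iff.2 ⟨n * ⌊x.1.1⌋ * ⌊x.1.2⌋, ?_⟩)
  rw [Int.fract]
  push_cast
  ring

theorem logBranch_deck (n a b : ℤ) (x : (ℝ × ℝ) × ℂ) : logBranch n (deck n a b x) =
    logBranch n x - 2 * Real.pi * Complex.I * (n * a * Int.fract x.1.2) := by
  obtain ⟨⟨s, t⟩, v⟩ := x
  simp only [logBranch, deck_apply, Int.floor_add_intCast, Int.fract_add_intCast]
  have h : Complex.exp (-(2 * Real.pi * Complex.I * (n * a * t))) * v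
      * Complex.exp (2 * Real.pi * Complex.I * (n * (⌊s⌋ + a : ℤ) * (t + b : ℝ)))
      = v * Complex.exp (2 * Real.pi * Complex.I * (n * ⌊s⌋ * t)) := by
    rw [mul_right_comm, ← Complex.exp_add, mul_comm]
    congr 1
    refine Complex.exp_eq_exp_iff_exists_int.2 ⟨n * (⌊s⌋ + a) * b, ?_⟩
    push_cast
    ring
  rw [h]
  push_cast
  ring

theorem exists_logBranch_eq (n : ℤ) {x : (ℝ × ℝ) × ℂ} {l : ℂ} (h : Complex.exp l = x.2) :
    ∃ k : ℤ, l = logBranch n x + k * (2 * Real.pi * Complex.I) := by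
  have hx : x.2 ≠ 0 := h ▸ Complex.exp_ne_zero l
  exact Complex.exp_eq_exp_iff_exists_int.1 (h.trans (exp_logBranch n hx).symm)

/-- Two continuous logarithms along γ differ by a constant, so the integer does not depend on `l`.
-/
theorem exists_winding (n : ℤ) (γ : SingularSimplex 1 ((ℝ × ℝ) × ℂ)) (h : ∀ p, (γ p).2 ≠ 0) :
    ∃ k : ℤ, ∀ l : C(stdSimplex ℝ (Fin 2), ℂ), (∀ p, Complex.exp (l p) = (γ p).2) →
      l (stdSimplex.vertex 1) - l (stdSimplex.vertex 0)
        = logBranch n (γ (stdSimplex.vertex 1)) - logBranch n (γ (stdSimplex.vertex 0))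
          + k * (2 * Real.pi * Complex.I) := by
  obtain ⟨l, hl⟩ := exists_log (ContinuousMap.snd.comp γ) h
  obtain ⟨k₀, hk₀⟩ := exists_logBranch_eq n (hl (stdSimplex.vertex 0))
  obtain ⟨k₁, hk₁⟩ := exists_logBranch_eq n (hl (stdSimplex.vertex 1))
  refine ⟨k₁ - k₀, fun l' hl' => ?_⟩
  obtain ⟨k, hk⟩ := exists_int_of_exp_eq l.continuous l'.continuous fun x =>
    (hl x).trans (hl' x).symm
  rw [hk, hk, hk₀, hk₁]
  push_cast
  ring

open Classical in
/-- An integral `1`-cochain on `ℝ² × ℂ` which measures the winding of paths in the complement of the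
zero section. -/
def windingCochain (n : ℤ) (γ : SingularSimplex 1 ((ℝ × ℝ) × ℂ)) : ℤ :=
  -- The chosen integer changes under `deck n a b` by -n a times the increment of ⌊t⌋, and the floor
  -- term changes by the opposite amount. The default 0 respects invariance because `deck` preserves
  -- the zero section.
  if h : ∀ p, (γ p).2 ≠ 0 then (exists_winding n γ h).choose
    + n * ⌊(γ (stdSimplex.vertex 0)).1.1⌋
      * (⌊(γ (stdSimplex.vertex 1)).1.2⌋ - ⌊(γ (stdSimplex.vertex 0)).1.2⌋) else 0

theorem windingCochain_eq {n : ℤ} {γ : SingularSimplex 1 ((ℝ × ℝ) × ℂ)}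
    (l : C(stdSimplex ℝ (Fin 2), ℂ)) (hl : ∀ p, Complex.exp (l p) = (γ p).2)
    {x y : (ℝ × ℝ) × ℂ} (hx : γ (stdSimplex.vertex 0) = x) (hy : γ (stdSimplex.vertex 1) = y)
    {j k : ℤ} (hj : l (stdSimplex.vertex 0) = logBranch n x + j * (2 * Real.pi * Complex.I))
    (hk : l (stdSimplex.vertex 1) = logBranch n y + k * (2 * Real.pi * Complex.I)) :
    windingCochain n γ = k - j + n * ⌊x.1.1⌋ * (⌊y.1.2⌋ - ⌊x.1.2⌋) := by
  have h : ∀ p, (γ p).2 ≠ 0 := fun p => hl p ▸ Complex.exp_ne_zero _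
  subst hx hy
  have h1 := (exists_winding n γ h).choose_spec l hl
  rw [windingCochain, dif_pos h]
  congr 1
  rw [hj, hk] at h1
  have h2 : ((k - j - (exists_winding n γ h).choose : ℤ) : ℂ) * (2 * Real.pi * Complex.I) = 0 := by
    push_cast
    linear_combination h1
  have h3 := (mul_eq_zero.1 h2).resolve_right Complex.two_pi_I_ne_zero
  have h4 : k - j - (exists_winding n γ h).choose = 0 := by exact_mod_cast h3
  linarith

theorem windingCochain_deck (n a b : ℤ) (γ : SingularSimplex 1 ((ℝ × ℝ) × ℂ)) :
    windingCochain n ((deck n a b).comp γ) = windingCochain n γ := by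
  by_cases h : ∀ p, (γ p).2 ≠ 0
  · obtain ⟨l, hl⟩ := exists_log (ContinuousMap.snd.comp γ) h
    obtain ⟨k₀, hk₀⟩ := exists_logBranch_eq n (hl (stdSimplex.vertex 0))
    obtain ⟨k₁, hk₁⟩ := exists_logBranch_eq n (hl (stdSimplex.vertex 1))
    rw [windingCochain_eq l hl rfl rfl hk₀ hk₁]
    set x := γ (stdSimplex.vertex 0)
    set y := γ (stdSimplex.vertex 1)
    -- The logarithm moves by -2πi n a t but `logBranch` by -2πi n a {t}, so the integers at the
    -- ends move by -n a ⌊t⌋.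
    let l' : C(stdSimplex ℝ (Fin 2), ℂ) :=
      ⟨fun p => l p - 2 * Real.pi * Complex.I * (n * a * (γ p).1.2), by fun_prop⟩
    rw [windingCochain_eq (x := deck n a b x) (y := deck n a b y) (j := k₀ - n * a * ⌊x.1.2⌋)
      (k := k₁ - n * a * ⌊y.1.2⌋) l' ?_ rfl rfl ?_ ?_]
    · have e1 : (deck n a b x).1.1 = x.1.1 + a := rfl
      have e2 : (deck n a b x).1.2 = x.1.2 + b := rfl
      have e3 : (deck n a b y).1.2 = y.1.2 + b := rfl
      rw [e1, e2, e3, Int.floor_add_intCast, Int.floor_add_intCast, Int.floor_add_intCast]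
      ring
    · intro p
      change Complex.exp (l p - _) = Complex.exp (-_) * (γ p).2
      have e : Complex.exp (l p) = (γ p).2 := hl p
      rw [sub_eq_neg_add, Complex.exp_add, e]
    · change l (stdSimplex.vertex 0) - 2 * Real.pi * Complex.I * (n * a * x.1.2) = _
      have e : logBranch n (γ (stdSimplex.vertex 0)) = logBranch n x := rfl
      rw [logBranch_deck, hk₀, e, Int.fract]
      push_cast
      ring
    · change l (stdSimplex.vertex 1) - 2 * Real.pi * Complex.I * (n * a * y.1.2) = _
      have e : logBranch n (γ (stdSimplex.vertex 1)) = logBranch n y := rfl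
      rw [logBranch_deck, hk₁, e, Int.fract]
      push_cast
      ring
  · have h' : ¬ ∀ p, ((deck n a b).comp γ p).2 ≠ 0 := by
      contrapose h
      intro p
      exact right_ne_zero_of_mul (h p)
    rw [windingCochain, windingCochain, dif_neg h, dif_neg h']

/-- The cup product of the `1`-cocycles `-n δ⌊s⌋` and `δ⌊t⌋`. -/
def floorCocycle (n : ℤ) (σ : SingularSimplex 2 ((ℝ × ℝ) × ℂ)) : ℤ :=
  -n * (⌊(σ (stdSimplex.vertex 1)).1.1⌋ - ⌊(σ (stdSimplex.vertex 0)).1.1⌋)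
    * (⌊(σ (stdSimplex.vertex 2)).1.2⌋ - ⌊(σ (stdSimplex.vertex 1)).1.2⌋)

theorem floorCocycle_deck (n a b : ℤ) (σ : SingularSimplex 2 ((ℝ × ℝ) × ℂ)) :
    floorCocycle n ((deck n a b).comp σ) = floorCocycle n σ := by
  have e1 (p) : ((deck n a b).comp σ p).1.1 = (σ p).1.1 + a := rfl
  have e2 (p) : ((deck n a b).comp σ p).1.2 = (σ p).1.2 + b := rfl
  simp only [floorCocycle, e1, e2, Int.floor_add_intCast]
  ring

theorem delta_floorCocycle (n : ℤ) : delta (floorCocycle n) = 0 := by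
  funext σ
  rw [delta_two_apply]
  simp only [floorCocycle, face_vertex]
  have h0 (k : Fin 3) : (0 : Fin 4).succAbove k = ![1, 2, 3] k := by revert k; decide
  have h1 (k : Fin 3) : (1 : Fin 4).succAbove k = ![0, 2, 3] k := by revert k; decide
  have h2 (k : Fin 3) : (2 : Fin 4).succAbove k = ![0, 1, 3] k := by revert k; decide
  have h3 (k : Fin 3) : (3 : Fin 4).succAbove k = ![0, 1, 2] k := by revert k; decide
  simp [h0, h1, h2, h3]
  ring

/-- U is the coboundary of `windingCochain` plus `floorCocycle`. Both summands are closed and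
invariant. Off the zero section the floor correction in the winding cochain has coboundary exactly
`-floorCocycle`. -/
theorem exists_invariant_cocycle (n : ℤ) : ∃ U : SingularSimplex 2 ((ℝ × ℝ) × ℂ) → ℤ,
    delta U = 0 ∧ (∀ a b σ, U ((deck n a b).comp σ) = U σ) ∧
    (∀ σ, (∀ p, (σ p).2 ≠ 0) → U σ = 0) ∧
    ∀ (x : ℝ × ℝ) (w : ℂ), w ≠ 0 →
      U (affineMapSimplex ![(x, w), (x, zeta * w), (x, zeta ^ 2 * w)]) = 1 := by
  refine ⟨fun σ => delta (windingCochain n) σ - -floorCocycle n σ, ?_, ?_, ?_, ?_⟩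
  · rw [delta_sub, delta_delta]
    funext σ
    have := congrFun (delta_floorCocycle n) σ
    simp only [delta, mul_neg, Finset.sum_neg_distrib] at this ⊢
    simp [this]
  · intro a b σ
    beta_reduce
    rw [floorCocycle_deck]
    congr 1
    exact Finset.sum_congr rfl fun i _ => congrArg _ (windingCochain_deck n a b (face i σ))
  · intro σ hσ
    obtain ⟨l, hl⟩ := exists_log (ContinuousMap.snd.comp σ) hσ
    choose k hk using fun i => exists_logBranch_eq n (hl (stdSimplex.vertex i))
    have hface (i : Fin 3) := windingCochain_eq (n := n) (γ := face i σ) (face i l)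
      (fun p => hl _) (face_vertex σ i 0) (face_vertex σ i 1)
      ((face_vertex l i 0).trans (hk _)) ((face_vertex l i 1).trans (hk _))
    beta_reduce
    -- With one logarithm on the whole simplex the integers k telescope. What is left is n(⌊s₁⌋ -
    -- ⌊s₀⌋)(⌊t₂⌋ - ⌊t₁⌋), which cancels the floor cocycle.
    rw [delta_one_apply, hface, hface, hface, floorCocycle]
    simp [Fin.succAbove]
    ring
  · intro x w hw
    have hc : floorCocycle n (affineMapSimplex ![(x, w), (x, zeta * w), (x, zeta ^ 2 * w)]) = 0 := by
      rw [floorCocycle, affineMapSimplex_vertex, affineMapSimplex_vertex, affineMapSimplex_vertex]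
      simp
    beta_reduce
    rw [hc, delta_affineMapSimplex]
    have hz : Complex.exp (2 * Real.pi * Complex.I / 3) = zeta := rfl
    obtain ⟨k₀, hk₀⟩ := exists_logBranch_eq n (x := (x, w)) (Complex.exp_log hw)
    obtain ⟨k₁, hk₁⟩ := exists_logBranch_eq n (x := (x, zeta * w))
      (l := 2 * Real.pi * Complex.I / 3 + Complex.log w) (by
        rw [Complex.exp_add, Complex.exp_log hw, hz])
    obtain ⟨k₂, hk₂⟩ := exists_logBranch_eq n (x := (x, zeta ^ 2 * w))
      (l := 2 * Real.pi * Complex.I / 3 + (2 * Real.pi * Complex.I / 3 + Complex.log w)) (by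
        rw [Complex.exp_add, Complex.exp_add, Complex.exp_log hw, hz]
        ring)
    have hv (a b : (ℝ × ℝ) × ℂ) : affineMapSimplex ![a, b] (stdSimplex.vertex 0) = a :=
      affineMapSimplex_vertex ![a, b] 0
    have hv' (a b : (ℝ × ℝ) × ℂ) : affineMapSimplex ![a, b] (stdSimplex.vertex 1) = b :=
      affineMapSimplex_vertex ![a, b] 1
    have h₁ := windingCochain_eq (n := n) (j := k₀) (k := k₁)
      (chordLog zeta_im_ne_zero + ContinuousMap.const _ (Complex.log w)) (fun p => by
        rw [affineMapSimplex_pair_apply]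
        change Complex.exp (chordLog zeta_im_ne_zero p + Complex.log w) = p 0 • w + p 1 • (zeta * w)
        rw [Complex.exp_add, exp_chordLog, Complex.exp_log hw]
        simp
        ring) (hv (x, w) (x, zeta * w)) (hv' _ _) (by
        change chordLog _ (stdSimplex.vertex 0) + Complex.log w = _
        rw [chordLog_vertex_zero, zero_add, hk₀]) (by
        change chordLog _ (stdSimplex.vertex 1) + Complex.log w = _
        rw [chordLog_vertex_one, log_zeta, hk₁])
    have h₂ := windingCochain_eq (n := n) (j := k₁) (k := k₂)
      (chordLog zeta_im_ne_zero
        + ContinuousMap.const _ (2 * Real.pi * Complex.I / 3 + Complex.log w)) (fun p => by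
        rw [affineMapSimplex_pair_apply]
        change Complex.exp (chordLog zeta_im_ne_zero p
          + (2 * Real.pi * Complex.I / 3 + Complex.log w))
          = p 0 • (zeta * w) + p 1 • (zeta ^ 2 * w)
        rw [Complex.exp_add, Complex.exp_add, exp_chordLog, Complex.exp_log hw, hz]
        simp
        ring) (hv (x, zeta * w) (x, zeta ^ 2 * w)) (hv' _ _) (by
        change chordLog _ (stdSimplex.vertex 0) + _ = _
        rw [chordLog_vertex_zero, zero_add]
        exact hk₁) (by
        change chordLog _ (stdSimplex.vertex 1) + _ = _
        rw [chordLog_vertex_one, log_zeta]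
        exact hk₂)
    -- The direct edge from w to ζ²w ends at log w - 2πi/3, one turn below the endpoint log w +
    -- 4πi/3 reached through ζw. This `- 1` gives the normalization.
    have h₃ := windingCochain_eq (n := n) (j := k₀) (k := k₂ - 1)
      (chordLog zeta_sq_im_ne_zero + ContinuousMap.const _ (Complex.log w)) (fun p => by
        rw [affineMapSimplex_pair_apply]
        change Complex.exp (chordLog zeta_sq_im_ne_zero p + Complex.log w)
          = p 0 • w + p 1 • (zeta ^ 2 * w)
        rw [Complex.exp_add, exp_chordLog, Complex.exp_log hw]
        simp
        ring) (hv (x, w) (x, zeta ^ 2 * w)) (hv' _ _) (by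
        change chordLog _ (stdSimplex.vertex 0) + Complex.log w = _
        rw [chordLog_vertex_zero, zero_add, hk₀]) (by
        change chordLog _ (stdSimplex.vertex 1) + Complex.log w = _
        rw [chordLog_vertex_one, log_zeta_sq]
        push_cast
        linear_combination hk₂)
    rw [h₁, h₂, h₃]
    ring

/-! ### Continuity of families of vectors of a vector bundle -/

section Sections

variable {B F Z : Type*} [TopologicalSpace B] [TopologicalSpace Z] [NormedAddCommGroup F]
  {E : B → Type*} [∀ b, TopologicalSpace (E b)]
  [TopologicalSpace (TotalSpace F E)] [FiberBundle F E]

theorem continuousAt_coord {f : Z → B} {s : ∀ z, E (f z)}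
    (hs : Continuous fun z => (⟨f z, s z⟩ : TotalSpace F E)) (b : B) {z : Z}
    (hz : f z ∈ (trivializationAt F E b).baseSet) :
    ContinuousAt (fun z => (trivializationAt F E b ⟨f z, s z⟩).2) z := by
  have h1 : ContinuousAt (trivializationAt F E b) (⟨f z, s z⟩ : TotalSpace F E) :=
    (trivializationAt F E b).continuousAt ((trivializationAt F E b).mem_source.2 hz)
  exact (ContinuousAt.comp (f := fun z => (⟨f z, s z⟩ : TotalSpace F E)) h1 hs.continuousAt).snd

theorem continuous_base {f : Z → B} {s : ∀ z, E (f z)}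
    (hs : Continuous fun z => (⟨f z, s z⟩ : TotalSpace F E)) : Continuous f :=
  (FiberBundle.continuous_proj F E).comp hs

theorem eventually_mem_baseSet {f : Z → B} (hf : Continuous f) (z : Z) :
    ∀ᶠ y in nhds z, f y ∈ (trivializationAt F E (f z)).baseSet :=
  hf.continuousAt ((trivializationAt F E (f z)).open_baseSet.mem_nhds
    (FiberBundle.mem_baseSet_trivializationAt F E (f z)))

theorem continuous_section_of_coord {f : Z → B} {s : ∀ z, E (f z)} (hf : Continuous f)
    (h : ∀ z, ContinuousAt (fun y => (trivializationAt F E (f z) ⟨f y, s y⟩).2) z) :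
    Continuous fun z => (⟨f z, s z⟩ : TotalSpace F E) :=
  continuous_iff_continuousAt.2 fun z =>
    (FiberBundle.continuousAt_totalSpace F _).2 ⟨hf.continuousAt, h z⟩

variable [NormedSpace ℂ F] [∀ b, AddCommGroup (E b)] [∀ b, Module ℂ (E b)] [VectorBundle ℂ F E]

theorem continuous_smul_section {f : Z → B} {s : ∀ z, E (f z)}
    (hs : Continuous fun z => (⟨f z, s z⟩ : TotalSpace F E)) {c : Z → ℂ} (hc : Continuous c) :
    Continuous fun z => (⟨f z, c z • s z⟩ : TotalSpace F E) := by
  have hf := continuous_base hs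
  refine continuous_section_of_coord hf fun z => ?_
  refine (hc.continuousAt.smul (continuousAt_coord hs (f z)
    (FiberBundle.mem_baseSet_trivializationAt F E (f z)))).congr ?_
  filter_upwards [eventually_mem_baseSet (F := F) (E := E) hf z] with y hy
  exact (((trivializationAt F E (f z)).linear ℂ hy).map_smul _ _).symm

theorem continuous_add_section {f : Z → B} {s t : ∀ z, E (f z)}
    (hs : Continuous fun z => (⟨f z, s z⟩ : TotalSpace F E))
    (ht : Continuous fun z => (⟨f z, t z⟩ : TotalSpace F E)) :
    Continuous fun z => (⟨f z, s z + t z⟩ : TotalSpace F E) := by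
  have hf := continuous_base hs
  refine continuous_section_of_coord hf fun z => ?_
  refine ((continuousAt_coord hs (f z) (FiberBundle.mem_baseSet_trivializationAt F E (f z))).add
    (continuousAt_coord ht (f z) (FiberBundle.mem_baseSet_trivializationAt F E (f z)))).congr ?_
  filter_upwards [eventually_mem_baseSet (F := F) (E := E) hf z] with y hy
  exact (((trivializationAt F E (f z)).linear ℂ hy).map_add _ _).symm

theorem continuous_sum_section {ι : Type*} (I : Finset ι) {f : Z → B} (hf : Continuous f)
    {s : ι → ∀ z, E (f z)}
    (hs : ∀ i ∈ I, Continuous fun z => (⟨f z, s i z⟩ : TotalSpace F E)) :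
    Continuous fun z => (⟨f z, ∑ i ∈ I, s i z⟩ : TotalSpace F E) := by
  classical
  induction I using Finset.induction_on with
  | empty =>
    simp only [Finset.sum_empty]
    exact (Bundle.Trivialization.continuous_zeroSection (F := F) (E := E) ℂ).comp hf
  | insert i I hi ih =>
    simp only [Finset.sum_insert hi]
    exact continuous_add_section (hs i (by simp)) (ih fun j hj => hs j (by simp [hj]))

end Sections

/-! ### Line bundles on the torus -/

section LineBundle

/-- The universal covering of the torus. -/
def torusMk (x : ℝ × ℝ) : Torus := ((x.1 : UnitAddCircle), (x.2 : UnitAddCircle))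

variable (L : Torus → Type*) [∀ b, AddCommGroup (L b)] [∀ b, Module ℂ (L b)]
    [∀ b, TopologicalSpace (L b)] [TopologicalSpace (TotalSpace ℂ L)] [FiberBundle ℂ L]
    [VectorBundle ℂ ℂ L]

/-- A nowhere vanishing section of the pullback of a line bundle on the torus to `ℝ²`, which
exhibits the line bundle as the quotient of `ℝ² × ℂ` by the transformations `deck n a b`. -/
structure TwistedFrame (n : ℤ) where
  vec : ∀ x : ℝ × ℝ, L (torusMk x)
  vec_ne_zero : ∀ x, vec x ≠ 0
  continuous_vec : Continuous fun x => (⟨torusMk x, vec x⟩ : TotalSpace ℂ L)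
  map_deck : ∀ (a b : ℤ) (x : (ℝ × ℝ) × ℂ),
    (⟨torusMk (deck n a b x).1, (deck n a b x).2 • vec (deck n a b x).1⟩ : TotalSpace ℂ L)
      = ⟨torusMk x.1, x.2 • vec x.1⟩

variable {L} {n : ℤ} (fr : TwistedFrame L n)

namespace TwistedFrame

/-- The map `ℝ² × ℂ → L` defined by a frame. -/
def total : C((ℝ × ℝ) × ℂ, TotalSpace ℂ L) where
  toFun x := ⟨torusMk x.1, x.2 • fr.vec x.1⟩
  continuous_toFun :=
    continuous_smul_section (fr.continuous_vec.comp continuous_fst) continuous_snd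

theorem total_apply (x : (ℝ × ℝ) × ℂ) : fr.total x = ⟨torusMk x.1, x.2 • fr.vec x.1⟩ := rfl

theorem total_comp_deck (a b : ℤ) : fr.total.comp (deck n a b) = fr.total :=
  ContinuousMap.ext fun x => fr.map_deck a b x

theorem total_injective {y : ℝ × ℝ} {v w : ℂ} (h : fr.total (y, v) = fr.total (y, w)) :
    v = w := by
  rw [total_apply, total_apply, TotalSpace.mk_inj] at h
  exact smul_left_injective ℂ (fr.vec_ne_zero y) h

theorem exists_total_eq (p : TotalSpace ℂ L) (y : ℝ × ℝ) (h : torusMk y = p.proj) :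
    ∃ v, fr.total (y, v) = p := by
  obtain ⟨b, w⟩ := p
  subst h
  let e := VectorBundle.continuousLinearEquivAt ℂ ℂ L (torusMk y)
  refine ⟨e w / e (fr.vec y), ?_⟩
  rw [total_apply, TotalSpace.mk_inj]
  apply e.injective
  have : e (fr.vec y) ≠ 0 := (map_ne_zero_iff e e.injective).2 (fr.vec_ne_zero y)
  rw [map_smul, smul_eq_mul, div_mul_cancel₀ _ this]

theorem coord_total (b : Torus) (x : (ℝ × ℝ) × ℂ)
    (h : torusMk x.1 ∈ (trivializationAt ℂ L b).baseSet) :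
    (trivializationAt ℂ L b (fr.total x)).2
      = x.2 * (trivializationAt ℂ L b ⟨torusMk x.1, fr.vec x.1⟩).2 :=
  ((trivializationAt ℂ L b).linear ℂ h).map_smul _ _

theorem coord_vec_ne_zero (b : Torus) (y : ℝ × ℝ)
    (h : torusMk y ∈ (trivializationAt ℂ L b).baseSet) :
    (trivializationAt ℂ L b ⟨torusMk y, fr.vec y⟩).2 ≠ 0 := by
  exact (map_ne_zero_iff ((trivializationAt ℂ L b).linearEquivAt ℂ (torusMk y) h)
    (LinearEquiv.injective _)).2 (fr.vec_ne_zero y)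

section Lift

variable {A : Type*} [TopologicalSpace A]

/-- The base point lifts through ℝ → ℝ/ℤ in each coordinate. The fibre coordinate is then
determined, and it is continuous as the quotient of the local coordinates of σ and of the frame. -/
theorem exists_lift [SimplyConnectedSpace A] [LocallyPathConnectedSpace A]
    (σ : C(A, TotalSpace ℂ L)) : ∃ τ : C(A, (ℝ × ℝ) × ℂ), fr.total.comp τ = σ := by
  have hproj : Continuous fun x => (σ x).proj := (FiberBundle.continuous_proj ℂ L).comp σ.continuous
  obtain ⟨s, hs⟩ := exists_real_lift (A := A) ⟨fun x => (σ x).proj.1, continuous_fst.comp hproj⟩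
  obtain ⟨t, ht⟩ := exists_real_lift (A := A) ⟨fun x => (σ x).proj.2, continuous_snd.comp hproj⟩
  have hy (x : A) : torusMk (s x, t x) = (σ x).proj := Prod.ext (hs x) (ht x)
  choose v hv using fun x => fr.exists_total_eq (σ x) (s x, t x) (hy x)
  have hst : Continuous fun x => (s x, t x) := s.continuous.prodMk t.continuous
  refine ⟨⟨fun x => ((s x, t x), v x), hst.prodMk ?_⟩, ContinuousMap.ext hv⟩
  refine continuous_iff_continuousAt.2 fun x => ?_
  have hvec : Continuous fun x => (⟨torusMk (s x, t x), fr.vec (s x, t x)⟩ : TotalSpace ℂ L) :=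
    fr.continuous_vec.comp hst
  have hmem := FiberBundle.mem_baseSet_trivializationAt ℂ L (σ x).proj
  have h1 := continuousAt_coord (F := ℂ) (f := fun x => (σ x).proj) (s := fun x => (σ x).2)
    σ.continuous (σ x).proj hmem
  have h2 := continuousAt_coord hvec (σ x).proj (z := x) (by rw [hy]; exact hmem)
  refine (h1.div h2 (fr.coord_vec_ne_zero _ _ (by rw [hy]; exact hmem))).congr ?_
  filter_upwards [eventually_mem_baseSet (F := ℂ) (E := L) hproj x] with z hz
  rw [← hy z] at hz
  have := fr.coord_total (σ x).proj ((s z, t z), v z) hz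
  rw [hv] at this
  change (trivializationAt ℂ L (σ x).proj (σ z)).2 / _ = _
  rw [this, mul_div_cancel_right₀ _ (fr.coord_vec_ne_zero _ _ hz)]

/-- The base coordinates differ by constant integers because the domain is connected. The fibre
coordinates then agree because `total` is injective on each fibre. -/
theorem eq_deck_comp [PreconnectedSpace A] [Nonempty A] {τ τ' : C(A, (ℝ × ℝ) × ℂ)}
    (h : fr.total.comp τ = fr.total.comp τ') : ∃ a b : ℤ, τ' = (deck n a b).comp τ := by
  have h1 (x : A) : fr.total (τ x) = fr.total (τ' x) := ContinuousMap.congr_fun h x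
  have h2 (x : A) : torusMk (τ x).1 = torusMk (τ' x).1 := congrArg TotalSpace.proj (h1 x)
  obtain ⟨a, ha⟩ := exists_int_of_coe_eq (f := fun x => (τ x).1.1) (g := fun x => (τ' x).1.1)
    (by fun_prop) (by fun_prop) fun x => congrArg Prod.fst (h2 x)
  obtain ⟨b, hb⟩ := exists_int_of_coe_eq (f := fun x => (τ x).1.2) (g := fun x => (τ' x).1.2)
    (by fun_prop) (by fun_prop) fun x => congrArg Prod.snd (h2 x)
  refine ⟨a, b, ContinuousMap.ext fun x => ?_⟩
  have h3 : (τ' x).1 = (deck n a b (τ x)).1 := Prod.ext (ha x) (hb x)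
  refine Prod.ext h3 (fr.total_injective (y := (τ' x).1) ?_)
  have h4 : fr.total (deck n a b (τ x)) = fr.total (τ x) := fr.map_deck a b (τ x)
  change fr.total (τ' x) = fr.total ((τ' x).1, (deck n a b (τ x)).2)
  rw [h3, ← h1, ← h4]

end Lift

theorem torusMk_surjective (b : Torus) : ∃ y, torusMk y = b := by
  obtain ⟨s, hs⟩ := QuotientAddGroup.mk_surjective b.1
  obtain ⟨t, ht⟩ := QuotientAddGroup.mk_surjective b.2
  exact ⟨(s, t), Prod.ext hs ht⟩

theorem fibreSimplex_eq (y : ℝ × ℝ) (c : ℂ) : fibreSimplex (torusMk y) (c • fr.vec y)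
    = fr.total.comp (affineMapSimplex ![(y, c), (y, zeta * c), (y, zeta ^ 2 * c)]) := by
  ext1 p
  have h1 := stdSimplex.sum_eq_one p
  rw [Fin.sum_univ_three] at h1
  have h2 : affineMapSimplex ![(y, c), (y, zeta * c), (y, zeta ^ 2 * c)] p
      = (y, (∑ i : Fin 3, (p i : ℂ) * zeta ^ (i : ℕ)) * c) := by
    rw [affineMapSimplex_apply, Fin.sum_univ_three, Fin.sum_univ_three]
    refine Prod.ext ?_ ?_
    · change p 0 • y + p 1 • y + p 2 • y = y
      rw [← add_smul, ← add_smul, h1, one_smul]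
    · simp
      ring
  change _ = fr.total _
  rw [h2, total_apply, mul_smul]
  rfl

/-- The invariant cocycle is evaluated on a lift of each simplex. Invariance makes the choice of
lift immaterial, so the faces of a lift may serve as lifts of the faces. -/
theorem exists_thomCocycle (fr : TwistedFrame L n) : ∃ u : Cocycles 2 (TotalSpace ℂ L), IsThomCocycle L u := by
  obtain ⟨U, hU, hdeck, hrel, hgen⟩ := exists_invariant_cocycle n
  have hlift (k : ℕ) (σ : SingularSimplex k (TotalSpace ℂ L)) :
      ∃ τ : SingularSimplex k ((ℝ × ℝ) × ℂ), fr.total.comp τ = σ := fr.exists_lift σ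
  let u : SingularSimplex 2 (TotalSpace ℂ L) → ℤ := fun σ => U (hlift 2 σ).choose
  have hu (τ : SingularSimplex 2 ((ℝ × ℝ) × ℂ)) : u (fr.total.comp τ) = U τ := by
    obtain ⟨a, b, h⟩ := fr.eq_deck_comp (hlift 2 (fr.total.comp τ)).choose_spec.symm
    exact (congrArg U h).trans (hdeck a b τ)
  have hu' : delta u = 0 := by
    funext σ
    obtain ⟨τ, rfl⟩ := hlift 3 σ
    refine Eq.trans ?_ (congrFun hU τ)
    exact Finset.sum_congr rfl fun i _ => congrArg _ (hu (face i τ))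
  refine ⟨⟨cochainOf u, cochainOf_mem_cocycles hu'⟩, fun σ hσ => ?_, fun b w hw => ?_⟩
  · obtain ⟨τ, rfl⟩ := hlift 2 σ
    refine (cochainOf_single _ _).trans ((hu τ).trans (hrel τ fun p hp => hσ p ?_))
    change (τ p).2 • fr.vec (τ p).1 = 0
    rw [hp, zero_smul]
  · obtain ⟨y, rfl⟩ := torusMk_surjective b
    obtain ⟨c, hc⟩ := fr.exists_total_eq ⟨torusMk y, w⟩ y rfl
    rw [total_apply, TotalSpace.mk_inj] at hc
    change c • fr.vec y = w at hc
    subst hc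
    refine (cochainOf_single _ _).trans ?_
    rw [fibreSimplex_eq, hu]
    exact hgen y c (smul_ne_zero_iff.1 hw).1

theorem exists_firstChernClass (fr : TwistedFrame L n) : ∃ c : Cohomology 1 Torus, IsFirstChernClassOfLine L c := by
  obtain ⟨u, hu⟩ := fr.exists_thomCocycle
  exact ⟨_, u, hu, rfl⟩

theorem zeroSection_comp_affineSimplex (v : Fin 3 → ℝ × ℝ) :
    ContinuousMap.comp ⟨zeroSection ℂ L, Bundle.Trivialization.continuous_zeroSection ℂ⟩
        (affineSimplex v)
      = fr.total.comp (affineMapSimplex fun i => (v i, (0 : ℂ))) := by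
  ext1 p
  have h : affineMapSimplex (fun i => (v i, (0 : ℂ))) p
      = ((∑ i, p i * (v i).1, ∑ i, p i * (v i).2), 0) := by
    rw [affineMapSimplex_apply]
    refine Prod.ext (Prod.ext ?_ ?_) ?_ <;> simp [Prod.fst_sum, Prod.snd_sum]
  change _ = fr.total _
  rw [h, total_apply, zero_smul]
  rfl

/-- The pullback along `total` of any Thom cocycle satisfies the hypotheses of `cocycle_square_eq`,
and the zero section over the fundamental chain lifts to the square in ℝ² × {0}. -/
theorem kronecker_eq (fr : TwistedFrame L n) {c : Cohomology 1 Torus} (hc : IsFirstChernClassOfLine L c) :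
    kronecker 1 Torus c fundamentalClass = -n := by
  obtain ⟨u, hu, rfl⟩ := hc
  rw [fundamentalClass, kronecker_mk]
  let U : SingularSimplex 2 ((ℝ × ℝ) × ℂ) → ℤ :=
    fun σ => u.1 (Finsupp.single (fr.total.comp σ) 1)
  have h := cocycle_square_eq n U
    ((delta_comp fr.total _).trans
      (funext fun σ => congrFun (delta_eq_zero_of_mem_cocycles u.2) (fr.total.comp σ)))
    (fun a b σ => by
      have : fr.total.comp ((deck n a b).comp σ) = fr.total.comp σ := by
        rw [← ContinuousMap.comp_assoc, fr.total_comp_deck]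
      exact congrArg (fun τ => u.1 (Finsupp.single τ 1)) this)
    (fun σ hσ => hu.relative _ fun p => smul_ne_zero (hσ p) (fr.vec_ne_zero _))
    (by
      have := hu.generator (torusMk (0, 0)) ((1 : ℂ) • fr.vec (0, 0))
        (smul_ne_zero one_ne_zero (fr.vec_ne_zero _))
      rw [fibreSimplex_eq, mul_one, mul_one] at this
      exact this)
  rw [← h]
  have e (x y z : ℝ × ℝ) : (fun i => ((![x, y, z] : Fin 3 → ℝ × ℝ) i, (0 : ℂ)))
      = ![(x, 0), (y, 0), (z, 0)] := by
    funext i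
    fin_cases i <;> rfl
  change u.1 (chainMap 2 _ fundamentalChain) = _
  rw [fundamentalChain, map_sub, map_sub]
  simp only [chainMap, Finsupp.lmapDomain_apply, Finsupp.mapDomain_single,
    fr.zeroSection_comp_affineSimplex, e]
  rfl

end TwistedFrame

end LineBundle

/-! ### Embedding a vector bundle over a compact space into a trivial one -/

section Embedding

variable {B F : Type*} [TopologicalSpace B] [NormedAddCommGroup F]
  [NormedSpace ℂ F] {E : B → Type*} [∀ b, AddCommGroup (E b)] [∀ b, Module ℂ (E b)]
  [∀ b, TopologicalSpace (E b)] [TopologicalSpace (TotalSpace F E)] [FiberBundle F E]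
  [VectorBundle ℂ F E]

theorem continuous_bump_smul_coord (b : B) {χ : B → ℝ} (hχ : Continuous χ)
    (hs : tsupport χ ⊆ (trivializationAt F E b).baseSet) : Continuous fun p : TotalSpace F E =>
      (χ p.proj : ℂ) • (trivializationAt F E b).linearMapAt ℂ p.proj p.2 := by
  have hproj := FiberBundle.continuous_proj F E
  refine continuous_iff_continuousAt.2 fun p => ?_
  by_cases hp : p.proj ∈ (trivializationAt F E b).baseSet
  · have h1 : ContinuousAt (fun p => (trivializationAt F E b p).2) p :=
      ((trivializationAt F E b).continuousAt ((trivializationAt F E b).mem_source.2 hp)).snd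
    refine ((Complex.continuous_ofReal.comp (hχ.comp hproj)).continuousAt.smul h1).congr ?_
    filter_upwards [hproj.continuousAt ((trivializationAt F E b).open_baseSet.mem_nhds hp)]
      with y hy
    rw [Bundle.Trivialization.linearMapAt_apply, if_pos (show y.proj ∈ _ from hy)]
    rfl
  · have h1 : ∀ᶠ y in nhds p, χ y.proj = 0 := by
      have h2 : p.proj ∉ tsupport χ := fun h => hp (hs h)
      filter_upwards [hproj.continuousAt ((isClosed_tsupport χ).isOpen_compl.mem_nhds h2)] with y hy
      exact image_eq_zero_of_notMem_tsupport hy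
    refine (continuousAt_const (y := (0 : F))).congr ?_
    filter_upwards [h1] with y hy
    rw [hy, Complex.ofReal_zero, zero_smul]

theorem continuous_bump_smul_symm (b : B) {χ : B → ℝ} (hχ : Continuous χ)
    (hs : tsupport χ ⊆ (trivializationAt F E b).baseSet) : Continuous fun p : B × F =>
      (⟨p.1, (χ p.1 : ℂ) • (trivializationAt F E b).symmₗ ℂ p.1 p.2⟩ : TotalSpace F E) := by
  refine continuous_section_of_coord continuous_fst fun p => ?_
  by_cases hp : p.1 ∈ (trivializationAt F E b).baseSet
  · have h1 : ContinuousAt (fun p : B × F => (trivializationAt F E b).toOpenPartialHomeomorph.symm p)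
        p := by
      refine (trivializationAt F E b).toOpenPartialHomeomorph.continuousAt_symm ?_
      exact (trivializationAt F E b).mem_target.2 hp
    have h2 : ContinuousAt (fun q : B × F => (trivializationAt F E p.1
        ((trivializationAt F E b).toOpenPartialHomeomorph.symm q)).2) p := by
      refine ContinuousAt.snd (ContinuousAt.comp (f := fun q : B × F =>
        (trivializationAt F E b).toOpenPartialHomeomorph.symm q)
        ((trivializationAt F E p.1).continuousAt ?_) h1)
      rw [(trivializationAt F E p.1).mem_source, (trivializationAt F E b).proj_symm_apply' hp]
      exact FiberBundle.mem_baseSet_trivializationAt F E p.1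
    refine (((Complex.continuous_ofReal.comp (hχ.comp continuous_fst)).continuousAt (x := p)).smul
      h2).congr ?_
    filter_upwards [continuous_fst.continuousAt ((trivializationAt F E b).open_baseSet.mem_nhds hp),
      eventually_mem_baseSet (F := F) (E := E) (continuous_fst (X := B) (Y := F)) p] with y hy hy'
    have e : (trivializationAt F E b).toOpenPartialHomeomorph.symm y
        = ⟨y.1, (trivializationAt F E b).symmₗ ℂ y.1 y.2⟩ := by
      rw [Bundle.Trivialization.symmₗ_apply _ hy, Bundle.Trivialization.mk_symm _ hy]
    change (χ y.1 : ℂ) • (trivializationAt F E p.1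
      ((trivializationAt F E b).toOpenPartialHomeomorph.symm y)).2 = _
    rw [e]
    exact (((trivializationAt F E p.1).linear ℂ hy').map_smul _ _).symm
  · have h1 : ∀ᶠ y : B × F in nhds p, χ y.1 = 0 := by
      have h2 : p.1 ∉ tsupport χ := fun h => hp (hs h)
      filter_upwards [continuous_fst.continuousAt
        ((isClosed_tsupport χ).isOpen_compl.mem_nhds h2)] with y hy
      exact image_eq_zero_of_notMem_tsupport hy
    refine (continuousAt_const (y := (0 : F))).congr ?_
    filter_upwards [h1, eventually_mem_baseSet (F := F) (E := E)
      (continuous_fst (X := B) (Y := F)) p] with y hy hy'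
    rw [hy, Complex.ofReal_zero, zero_smul]
    exact ((trivializationAt F E p.1).linear ℂ hy').map_zero.symm

variable (F E) in
/-- A finite family of maps of vector bundles `E → B × F → E` which compose and sum to the
identity. -/
structure Splitting (ι : Type*) [Fintype ι] where
  coord : ι → ∀ b, E b →ₗ[ℂ] F
  section' : ι → ∀ b, F →ₗ[ℂ] E b
  continuous_coord : ∀ i, Continuous fun p : TotalSpace F E => coord i p.proj p.2
  continuous_section : ∀ i, Continuous fun p : B × F => (⟨p.1, section' i p.1 p.2⟩ : TotalSpace F E)
  sum_eq : ∀ b (v : E b), ∑ i, section' i b (coord i b v) = v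

variable (F E) in
theorem exists_splitting [CompactSpace B] [T2Space B] :
    ∃ t : Finset B, Nonempty (Splitting F E t) := by
  obtain ⟨t, ht⟩ := isCompact_univ.elim_finite_subcover
    (fun b : B => (trivializationAt F E b).baseSet) (fun b => (trivializationAt F E b).open_baseSet)
    fun b _ => Set.mem_iUnion.2 ⟨b, FiberBundle.mem_baseSet_trivializationAt F E b⟩
  obtain ⟨ρ, hρ⟩ := PartitionOfUnity.exists_isSubordinate (isClosed_univ (X := B))
    (fun b : t => (trivializationAt F E b.1).baseSet)
    (fun b => (trivializationAt F E b.1).open_baseSet) (fun x hx => by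
      obtain ⟨b, hb, hx⟩ := Set.mem_iUnion₂.1 (ht hx)
      exact Set.mem_iUnion.2 ⟨⟨b, hb⟩, hx⟩)
  -- The square root serves as cutoff both into and out of the trivial bundle, so that each
  -- composition is multiplication by ρ.
  have hc (b : t) : Continuous fun x => √(ρ b x) := Real.continuous_sqrt.comp (ρ b).continuous
  have hs (b : t) : tsupport (fun x => √(ρ b x)) ⊆ (trivializationAt F E b.1).baseSet := by
    have h : Function.support (fun x => √(ρ b x)) ⊆ Function.support (ρ b) :=
      fun x hx h => hx (by simp [show ρ b x = 0 from h])
    exact (closure_mono h).trans (hρ b)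
  refine ⟨t, ⟨⟨fun b x => (√(ρ b x) : ℂ) • (trivializationAt F E b.1).linearMapAt ℂ x,
    fun b x => (√(ρ b x) : ℂ) • (trivializationAt F E b.1).symmₗ ℂ x,
    fun b => continuous_bump_smul_coord b.1 (hc b) (hs b),
    fun b => continuous_bump_smul_symm b.1 (hc b) (hs b), fun x v => ?_⟩⟩⟩
  have h1 (b : t) : ((√(ρ b x) : ℂ) • (trivializationAt F E b.1).symmₗ ℂ x)
      (((√(ρ b x) : ℂ) • (trivializationAt F E b.1).linearMapAt ℂ x) v) = (ρ b x : ℂ) • v := by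
    by_cases hx : x ∈ (trivializationAt F E b.1).baseSet
    · rw [LinearMap.smul_apply, LinearMap.smul_apply, map_smul,
        Bundle.Trivialization.symmₗ_linearMapAt _ hx, smul_smul, ← Complex.ofReal_mul,
        Real.mul_self_sqrt (ρ.nonneg b x)]
    · have h2 : ρ b x = 0 := by
        by_contra h
        exact hx (hρ b (subset_closure h))
      simp [h2]
  rw [Finset.sum_congr rfl fun b _ => h1 b, ← Finset.sum_smul, ← Complex.ofReal_sum]
  have h3 : ∑ b, ρ b x = 1 := by
    rw [← finsum_eq_sum_of_fintype]
    exact ρ.sum_eq_one (Set.mem_univ x)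
  rw [h3, Complex.ofReal_one, one_smul]

end Embedding

/-! ### Hermitian metrics -/

section Metric

variable {B F : Type*} [TopologicalSpace B] [NormedAddCommGroup F] [InnerProductSpace ℂ F]
  {E : B → Type*} [∀ b, AddCommGroup (E b)] [∀ b, Module ℂ (E b)]
  [TopologicalSpace (TotalSpace F E)]

theorem HermitianMetric.continuous_inner {Z : Type*} [TopologicalSpace Z]
    (h : HermitianMetric F E) {f : Z → B} {s t : ∀ z, E (f z)}
    (hs : Continuous fun z => (⟨f z, s z⟩ : TotalSpace F E))
    (ht : Continuous fun z => (⟨f z, t z⟩ : TotalSpace F E)) :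
    Continuous fun z => (h.form (f z)).inner (s z) (t z) := by
  have h1 : Continuous fun z => (⟨f z, (s z, t z)⟩ : TotalSpace (F × F) (E ×ᵇ E)) :=
    (FiberBundle.Prod.isInducing_diag F E F E).continuous_iff.2 (hs.prodMk ht)
  exact h.continuous_form.comp h1

theorem HermitianMetric.inner_congr (h : HermitianMetric F E) {x y : B} {a a' : E x} {b b' : E y}
    (h1 : (⟨x, a⟩ : TotalSpace F E) = ⟨y, b⟩) (h2 : (⟨x, a'⟩ : TotalSpace F E) = ⟨y, b'⟩) :
    (h.form x).inner a a' = (h.form y).inner b b' := by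
  obtain rfl : x = y := congrArg TotalSpace.proj h1
  rw [TotalSpace.mk_inj] at h1 h2
  rw [h1, h2]

/-- The Hermitian metric induced by a splitting. -/
def Splitting.metric {ι : Type*} [Fintype ι] (S : Splitting F E ι) : HermitianMetric F E where
  form b :=
    { inner := fun v w => ∑ i, inner ℂ (S.coord i b v) (S.coord i b w)
      conj_inner_symm := fun v w => by
        rw [map_sum]
        exact Finset.sum_congr rfl fun i _ => inner_conj_symm _ _
      re_inner_nonneg := fun v => by
        rw [map_sum]
        exact Finset.sum_nonneg fun i _ => inner_self_nonneg
      add_left := fun u v w => by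
        simp only [map_add, inner_add_left, Finset.sum_add_distrib]
      smul_left := fun v w r => by
        simp only [map_smul, inner_smul_left, Finset.mul_sum]
      definite := fun v h => by
        have h1 : ∑ i, ‖S.coord i b v‖ ^ 2 = 0 := by
          have h2 := congrArg Complex.re h
          simp only [inner_self_eq_norm_sq_to_K] at h2
          rw [Complex.re_sum] at h2
          rw [← Complex.zero_re, ← h2]
          refine Finset.sum_congr rfl fun i _ => ?_
          norm_cast
        -- Definiteness: v is recovered from its coordinates, all of which have norm 0.
        rw [← S.sum_eq b v]
        refine Finset.sum_eq_zero fun i hi => ?_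
        have h2 := (Finset.sum_eq_zero_iff_of_nonneg fun i _ => sq_nonneg _).1 h1 i hi
        rw [norm_eq_zero.1 (pow_eq_zero_iff two_ne_zero |>.1 h2), map_zero] }
  continuous_form := by
    have h := (FiberBundle.Prod.isInducing_diag F E F E).continuous
    refine continuous_finsetSum _ fun i _ => ?_
    exact ((S.continuous_coord i).comp (continuous_fst.comp h)).inner
      ((S.continuous_coord i).comp (continuous_snd.comp h))

end Metric

/-! ### Frames -/

section Frames

variable {B F : Type*} [NormedAddCommGroup F] [NormedSpace ℂ F]
  (E : B → Type*) [∀ b, AddCommGroup (E b)] [∀ b, Module ℂ (E b)]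
  [TopologicalSpace (TotalSpace F E)]
  {W W' : Type*} [TopologicalSpace W] [TopologicalSpace W']

variable (F) in
/-- The pullback of `E` along `f` is trivial. -/
def HasFrame (f : W → B) : Prop :=
  ∃ X : ∀ w, F →ₗ[ℂ] E (f w), (∀ w, Function.Injective (X w)) ∧
    Continuous fun p : W × F => (⟨f p.1, X p.1 p.2⟩ : TotalSpace F E)

variable {E}

theorem HasFrame.comp {f : W → B} (hf : HasFrame F E f) {g : W' → W} (hg : Continuous g) :
    HasFrame F E (f ∘ g) := by
  obtain ⟨X, hX, hX'⟩ := hf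
  exact ⟨fun w => X (g w), fun w => hX (g w), hX'.comp (hg.prodMap continuous_id)⟩

/-- A frame which is compatible with a quotient map descends. -/
theorem HasFrame.descend {f : W' → B} {g : W → W'} (hg : IsProperMap g)
    (hsurj : Function.Surjective g) (X : ∀ w, F →ₗ[ℂ] E (f (g w)))
    (hX : ∀ w, Function.Injective (X w))
    (hXc : Continuous fun p : W × F => (⟨f (g p.1), X p.1 p.2⟩ : TotalSpace F E))
    (hcomp : ∀ w w', g w = g w' → ∀ v,
      (⟨f (g w), X w v⟩ : TotalSpace F E) = ⟨f (g w'), X w' v⟩) : HasFrame F E f := by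
  have key (w' : W') : ∃ A : F →ₗ[ℂ] E (f w'), Function.Injective A ∧
      ∀ w, g w = w' → ∀ v, (⟨f (g w), X w v⟩ : TotalSpace F E) = ⟨f w', A v⟩ := by
    obtain ⟨w, rfl⟩ := hsurj w'
    exact ⟨X w, hX w, fun w' h v => hcomp w' w h v⟩
  choose A hA hA' using key
  refine ⟨A, hA, ?_⟩
  -- Properness of g, and not only its being a quotient map, ensures that the product with F is
  -- still a closed map.
  have hq : Topology.IsQuotientMap (Prod.map g (id : F → F)) :=
    (hg.prodMap isProperMap_id).isClosedMap.isQuotientMap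
      (hg.continuous.prodMap continuous_id) (hsurj.prodMap Function.surjective_id)
  refine hq.continuous_iff.2 (hXc.congr fun p => ?_)
  exact hA' (g p.1) p.1 rfl p.2

end Frames

/-! ### Transport between nearby fibres -/

section Transport

variable {B F : Type*} [TopologicalSpace B] [NormedAddCommGroup F] [NormedSpace ℂ F]
  {E : B → Type*} [∀ b, AddCommGroup (E b)] [∀ b, Module ℂ (E b)]
  [TopologicalSpace (TotalSpace F E)] {ι : Type*} [Fintype ι] (S : Splitting F E ι)

/-- The comparison map between nearby fibres defined by a splitting. -/
def Splitting.transport (x y : B) : E x →ₗ[ℂ] E y := ∑ i, S.section' i y ∘ₗ S.coord i x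

theorem Splitting.transport_apply (x y : B) (v : E x) :
    S.transport x y v = ∑ i, S.section' i y (S.coord i x v) := by
  simp [Splitting.transport]

variable [∀ b, TopologicalSpace (E b)] [FiberBundle F E] [VectorBundle ℂ F E]

theorem Splitting.continuous_transport {W : Type*} [TopologicalSpace W] {f g : W → B}
    {s : ∀ w, E (f w)} (hs : Continuous fun w => (⟨f w, s w⟩ : TotalSpace F E))
    (hg : Continuous g) :
    Continuous fun w => (⟨g w, S.transport (f w) (g w) (s w)⟩ : TotalSpace F E) := by
  simp only [S.transport_apply]
  exact continuous_sum_section _ hg fun i _ =>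
    (S.continuous_section i).comp (hg.prodMk ((S.continuous_coord i).comp hs))

/-- On the diagonal transport is the identity. In a local trivialization it is a continuous family
of operators, and invertible operators form an open set. -/
theorem Splitting.eventually_injective [FiniteDimensional ℂ F] (x₀ : B) :
    ∀ᶠ p : B × B in nhds (x₀, x₀), Function.Injective (S.transport p.1 p.2) := by
  have : CompleteSpace F := FiniteDimensional.complete ℂ F
  let e := trivializationAt F E x₀
  have hx₀ : x₀ ∈ e.baseSet := FiberBundle.mem_baseSet_trivializationAt F E x₀
  let M : B × B → F →L[ℂ] F := fun p => LinearMap.toContinuousLinearMap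
    (e.linearMapAt ℂ p.2 ∘ₗ S.transport p.1 p.2 ∘ₗ e.symmₗ ℂ p.1)
  have hM : ContinuousAt M (x₀, x₀) := by
    refine continuousAt_clm_apply.2 fun v => ?_
    have h1 : ContinuousAt (fun p : B × B => e.toOpenPartialHomeomorph.symm (p.1, v)) (x₀, x₀) := by
      refine ContinuousAt.comp (f := fun p : B × B => (p.1, v))
        (e.toOpenPartialHomeomorph.continuousAt_symm ?_) (by fun_prop)
      exact e.mem_target.2 hx₀
    have hgood : ∀ᶠ p : B × B in nhds (x₀, x₀), p.1 ∈ e.baseSet ∧ p.2 ∈ e.baseSet := by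
      rw [nhds_prod_eq]
      exact Filter.prod_mem_prod (e.open_baseSet.mem_nhds hx₀) (e.open_baseSet.mem_nhds hx₀)
    have hsymm (p : B × B) (hp : p.1 ∈ e.baseSet) : e.toOpenPartialHomeomorph.symm (p.1, v)
        = ⟨p.1, e.symmₗ ℂ p.1 v⟩ := by
      rw [Bundle.Trivialization.symmₗ_apply _ hp, Bundle.Trivialization.mk_symm _ hp]
    have h2 (i : ι) : ContinuousAt (fun p : B × B => S.coord i p.1 (e.symmₗ ℂ p.1 v)) (x₀, x₀) := by
      refine ((S.continuous_coord i).continuousAt.comp h1).congr ?_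
      filter_upwards [hgood] with p hp
      exact congrArg (fun q : TotalSpace F E => S.coord i q.proj q.2) (hsymm p hp.1)
    have h3 : Continuous fun q : B × (ι → F) =>
        (⟨q.1, ∑ i, S.section' i q.1 (q.2 i)⟩ : TotalSpace F E) :=
      continuous_sum_section _ continuous_fst fun i _ =>
        (S.continuous_section i).comp
          (continuous_fst.prodMk ((continuous_apply i).comp continuous_snd))
    have h4 := continuousAt_coord h3 x₀
      (z := (x₀, fun i => S.coord i x₀ (e.symmₗ ℂ x₀ v))) hx₀
    have h5 : ContinuousAt (fun p : B × B => (p.2, fun i => S.coord i p.1 (e.symmₗ ℂ p.1 v)))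
        (x₀, x₀) := continuousAt_snd.prodMk (continuousAt_pi.2 h2)
    refine (ContinuousAt.comp (f := fun p : B × B =>
      (p.2, fun i => S.coord i p.1 (e.symmₗ ℂ p.1 v))) h4 h5).congr ?_
    filter_upwards [hgood] with p hp
    change (e ⟨p.2, _⟩).2 = e.linearMapAt ℂ p.2 (S.transport p.1 p.2 (e.symmₗ ℂ p.1 v))
    rw [Bundle.Trivialization.linearMapAt_apply, if_pos hp.2, S.transport_apply]
  have hM₀ : M (x₀, x₀) = 1 := by
    ext v
    change e.linearMapAt ℂ x₀ (S.transport x₀ x₀ (e.symmₗ ℂ x₀ v)) = v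
    rw [S.transport_apply, S.sum_eq, Bundle.Trivialization.linearMapAt_symmₗ _ hx₀]
  have hunit : ∀ᶠ p in nhds (x₀, x₀), IsUnit (M p) :=
    hM (Units.isOpen.mem_nhds (by rw [hM₀]; exact isUnit_one))
  have hfst : ∀ᶠ p : B × B in nhds (x₀, x₀), p.1 ∈ e.baseSet :=
    continuous_fst.continuousAt (e.open_baseSet.mem_nhds hx₀)
  filter_upwards [hunit, hfst] with p hp hp1
  refine (injective_iff_map_eq_zero _).2 fun v hv => ?_
  have h1 : M p (e.linearMapAt ℂ p.1 v) = 0 := by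
    change e.linearMapAt ℂ p.2 (S.transport p.1 p.2 (e.symmₗ ℂ p.1 (e.linearMapAt ℂ p.1 v))) = 0
    rw [Bundle.Trivialization.symmₗ_linearMapAt _ hp1, hv, map_zero]
  have h2 : e.linearMapAt ℂ p.1 v = 0 := by
    obtain ⟨u, hu⟩ := hp
    have := congrArg ((u⁻¹ : (F →L[ℂ] F)ˣ) : F →L[ℂ] F) h1
    rw [← hu, map_zero, ← mul_apply_eq_comp, Units.inv_mul] at this
    exact this
  rw [← Bundle.Trivialization.symmₗ_linearMapAt (R := ℂ) e hp1 v, h2, map_zero]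

end Transport

/-! ### Triviality of a vector bundle over a cylinder -/

section Cylinder

variable {B F : Type*} [NormedAddCommGroup F] [NormedSpace ℂ F]
  {E : B → Type*} [∀ b, AddCommGroup (E b)] [∀ b, Module ℂ (E b)]

/-- A path of invertible linear maps from the identity to a given one. -/
theorem exists_path_injective [FiniteDimensional ℂ F] (k : F →ₗ[ℂ] F)
    (hk : Function.Injective k) :
    ∃ c : unitInterval → F →ₗ[ℂ] F, c 0 = LinearMap.id ∧ c 1 = k ∧
      (∀ t, Function.Injective (c t)) ∧
      Continuous fun p : unitInterval × F => c p.1 p.2 := by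
  let m : ℂ → F →ₗ[ℂ] F := fun z => (1 - z) • LinearMap.id + z • k
  have hm0 : m 0 = LinearMap.id := by simp [m]
  have hm1 : m 1 = k := by simp [m]
  have hcount : {z | ¬ Function.Injective (m z)}.Countable := by
    -- The segment (1 - z) id + z k, with z complex, degenerates only when μ = -(1 - z)/z is an
    -- eigenvalue of k, that is, z = (1 - μ)⁻¹. A plane minus a countable set is path connected, so
    -- 0 and 1 can be joined while avoiding these z.
    refine ((Module.End.finite_hasEigenvalue k).image fun μ => (1 - μ)⁻¹).countable.mono ?_
    intro z hz
    obtain ⟨v, hv, hv0⟩ : ∃ v, m z v = 0 ∧ v ≠ 0 := by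
      by_contra! h
      exact hz ((injective_iff_map_eq_zero _).2 h)
    have hv : (1 - z) • v + z • k v = 0 := hv
    have hz0 : z ≠ 0 := by
      rintro rfl
      simp at hv
      exact hv0 hv
    refine ⟨-((1 - z) / z), ?_, by field_simp; ring⟩
    refine Module.End.hasEigenvalue_of_hasEigenvector (x := v)
      ⟨Module.End.mem_eigenspace_iff.2 ?_, hv0⟩
    have h1 : z • k v = -((1 - z) • v) := eq_neg_of_add_eq_zero_right hv
    rw [neg_smul, div_eq_inv_mul, mul_smul, ← smul_neg, ← h1, smul_smul, inv_mul_cancel₀ hz0,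
      one_smul]
  have hjoin : JoinedIn {z | ¬ Function.Injective (m z)}ᶜ 0 1 :=
    (hcount.isPathConnected_compl_of_one_lt_rank (by simp [Complex.rank_real_complex])).joinedIn
      0 (by
        simp only [Set.mem_compl_iff, Set.mem_ofPred_eq, not_not, hm0]
        exact Function.injective_id) 1 (by simpa [hm1] using hk)
  refine ⟨fun t => m (hjoin.somePath t), by simpa using hm0, by simpa using hm1, fun t => ?_, ?_⟩
  · exact not_not.1 (hjoin.somePath_mem t)
  · have h1 : Continuous fun p : unitInterval × F => hjoin.somePath p.1 :=
      hjoin.somePath.continuous.comp continuous_fst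
    exact ((continuous_const.sub h1).smul continuous_snd).add
      (h1.smul ((LinearMap.continuous_of_finiteDimensional k).comp continuous_snd))

variable [TopologicalSpace B] [∀ b, TopologicalSpace (E b)] [TopologicalSpace (TotalSpace F E)]
  [FiberBundle F E] [VectorBundle ℂ F E]

theorem bijective_of_injective [FiniteDimensional ℂ F] {b : B} {A : F →ₗ[ℂ] E b}
    (hA : Function.Injective A) : Function.Bijective A := by
  let e := (trivializationAt F E b).linearEquivAt ℂ b
    (FiberBundle.mem_baseSet_trivializationAt F E b)
  refine ⟨hA, fun v => ?_⟩
  obtain ⟨w, hw⟩ := (LinearMap.injective_iff_surjective (f := e.toLinearMap ∘ₗ A)).1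
    (e.injective.comp hA) (e v)
  exact ⟨w, e.injective hw⟩

theorem exists_comparison [FiniteDimensional ℂ F] {x y : B} (h : x = y) {A : F →ₗ[ℂ] E x}
    (hA : Function.Injective A) {C : F →ₗ[ℂ] E y} (hC : Function.Injective C) :
    ∃ k : F →ₗ[ℂ] F, Function.Injective k ∧
      ∀ v, (⟨y, C (k v)⟩ : TotalSpace F E) = ⟨x, A v⟩ := by
  subst h
  let e := LinearEquiv.ofBijective C (bijective_of_injective hC)
  refine ⟨e.symm.toLinearMap ∘ₗ A, e.symm.injective.comp hA, fun v => ?_⟩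
  exact congrArg _ (e.apply_symm_apply (A v))

theorem HasFrame.of_transport {W ι : Type*} [TopologicalSpace W] [Fintype ι]
    (S : Splitting F E ι) {f g : W → B}
    (hf : HasFrame F E f) (hg : Continuous g)
    (hfg : ∀ w, Function.Injective (S.transport (f w) (g w))) : HasFrame F E g := by
  obtain ⟨X, hX, hXc⟩ := hf
  exact ⟨fun w => S.transport (f w) (g w) ∘ₗ X w, fun w => (hfg w).comp (hX w),
    S.continuous_transport hXc (hg.comp continuous_fst)⟩

theorem hasFrame_const (b : B) : HasFrame F E fun _ : Unit => b := by
  have hb := FiberBundle.mem_baseSet_trivializationAt F E b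
  refine ⟨fun _ => (trivializationAt F E b).symmₗ ℂ b, fun _ => ?_, ?_⟩
  · exact Function.LeftInverse.injective
      fun v => Bundle.Trivialization.linearMapAt_symmₗ (R := ℂ) (trivializationAt F E b) hb v
  · exact (FiberBundle.continuous_totalSpaceMk F E b).comp
      (((trivializationAt F E b).symmL ℂ b).continuous.comp continuous_snd)

end Cylinder

/-! ### Frames along homotopies and over the circle -/

section Homotopy

variable {B F : Type*} [NormedAddCommGroup F] [NormedSpace ℂ F] [FiniteDimensional ℂ F]
  {E : B → Type*} [∀ b, AddCommGroup (E b)] [∀ b, Module ℂ (E b)]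
  [MetricSpace B] [CompactSpace B]
  [∀ b, TopologicalSpace (E b)] [TopologicalSpace (TotalSpace F E)]
  [FiberBundle F E] [VectorBundle ℂ F E]

/-- By compactness transport is injective between all points closer than some ε. The map (z, u) ↦
H(z, 0) is deformed to H through (z, u) ↦ H(z, c u) with c = k/(N + 1), in steps so small that each
moves points by less than ε, and the frame is transported at each step. -/
theorem HasFrame.of_homotopy {Z : Type*} [MetricSpace Z] [CompactSpace Z]
    (H : C(Z × unitInterval, B)) (h0 : HasFrame F E fun z => H (z, 0)) : HasFrame F E H := by
  obtain ⟨t, ⟨S⟩⟩ := exists_splitting F E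
  have hU : {p : B × B | Function.Injective (S.transport p.1 p.2)} ∈ uniformity B := by
    rw [← nhdsSet_diagonal_eq_uniformity, mem_nhdsSet_iff_forall]
    rintro ⟨x, y⟩ (rfl : x = y)
    exact S.eventually_injective x
  obtain ⟨ε, hε, hH⟩ := Metric.mem_uniformity_dist.1
    (Filter.mem_map.1 <| CompactSpace.uniformContinuous_of_continuous H.continuous hU)
  obtain ⟨N, hN⟩ := exists_nat_one_div_lt hε
  let c : ℕ → unitInterval := fun k => Set.projIcc 0 1 zero_le_one ((k : ℝ) / (N + 1))
  have hc (k : ℕ) : dist (c k) (c (k + 1)) < ε := by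
    refine lt_of_le_of_lt ?_ hN
    refine (Set.abs_projIcc_sub_projIcc zero_le_one).trans_eq ?_
    have : (0 : ℝ) < N + 1 := by positivity
    rw [← sub_div, abs_div, abs_of_pos this]
    simp
  have key (k : ℕ) : HasFrame F E fun w : Z × unitInterval => H (w.1, c k * w.2) := by
    induction k with
    | zero =>
      have hc0 : c 0 = 0 := by
        ext
        simp [c, Set.projIcc]
      simp only [hc0, zero_mul]
      exact h0.comp continuous_fst
    | succ k ih =>
      refine ih.of_transport S (by fun_prop) fun w => ?_
      refine hH (a := (w.1, c k * w.2)) (b := (w.1, c (k + 1) * w.2)) ?_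
      rw [Prod.dist_eq, dist_self, max_eq_right dist_nonneg]
      refine lt_of_le_of_lt ?_ (hc k)
      rw [Subtype.dist_eq, Subtype.dist_eq, Real.dist_eq, Real.dist_eq]
      change |(c k : ℝ) * w.2 - (c (k + 1) : ℝ) * w.2| ≤ _
      rw [← sub_mul, abs_mul, abs_of_nonneg w.2.2.1]
      exact mul_le_of_le_one_right (abs_nonneg _) w.2.2.2
  have h1 : c (N + 1) = 1 := by
    ext
    have : (N : ℝ) + 1 ≠ 0 := by positivity
    simp [c, Set.projIcc, this]
  have h2 := key (N + 1)
  simp only [h1, one_mul] at h2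
  exact h2

/-- The parametrization of the circle by the unit interval. -/
def circleMk (t : unitInterval) : UnitAddCircle := ((t : ℝ) : UnitAddCircle)

theorem continuous_circleMk : Continuous circleMk :=
  (AddCircle.continuous_mk' 1).comp continuous_subtype_val

theorem circleMk_surjective : Function.Surjective circleMk := fun x => by
  obtain ⟨y, rfl⟩ := QuotientAddGroup.mk_surjective x
  exact ⟨⟨Int.fract y, Int.fract_nonneg y, (Int.fract_lt_one y).le⟩, AddCircle.coe_fract y⟩

theorem circleMk_zero_eq_one : circleMk 0 = circleMk 1 := by
  simpa [circleMk] using (AddCircle.coe_period (1 : ℝ)).symm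

theorem eq_of_circleMk_eq {s t : unitInterval} (h : circleMk s = circleMk t) :
    s = t ∨ s = 0 ∧ t = 1 ∨ s = 1 ∧ t = 0 := by
  have h1 : ((t - s : ℝ) : UnitAddCircle) = 0 := by
    rw [AddCircle.coe_sub, sub_eq_zero]
    exact h.symm
  obtain ⟨k, hk⟩ := (AddCircle.coe_eq_zero_iff _).1 h1
  have hk : (k : ℝ) = t - s := by simpa using hk
  have hs := s.2
  have ht := t.2
  have k1 : k ≤ 1 := by
    have : (k : ℝ) ≤ 1 := by linarith [hs.1, ht.2]
    exact_mod_cast this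
  have k2 : -1 ≤ k := by
    have : (-1 : ℝ) ≤ k := by linarith [hs.2, ht.1]
    exact_mod_cast this
  have hcases : k = -1 ∨ k = 0 ∨ k = 1 := by omega
  rcases hcases with rfl | rfl | rfl
  · right; right
    push_cast at hk
    exact ⟨Subtype.ext (le_antisymm hs.2 (by change (1 : ℝ) ≤ s; linarith [ht.1])),
      Subtype.ext (le_antisymm (by change (t : ℝ) ≤ 0; linarith [hs.2]) ht.1)⟩
  · left
    push_cast at hk
    exact Subtype.ext (by linarith)
  · right; left
    push_cast at hk
    exact ⟨Subtype.ext (le_antisymm (by change (s : ℝ) ≤ 0; linarith [ht.2]) hs.1),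
      Subtype.ext (le_antisymm ht.2 (by change (1 : ℝ) ≤ t; linarith [hs.1]))⟩

/-- A frame over [0, 1] has ends that differ by some invertible k. Composing it with a path from the
identity to k makes the ends agree, so that it descends to the circle; this uses that GL(F) is
connected. -/
theorem hasFrame_circle (f : C(UnitAddCircle, B)) : HasFrame F E f := by
  have h : HasFrame F E fun t => f (circleMk t) := by
    have h1 := HasFrame.of_homotopy (F := F) (E := E) (Z := Unit)
      ⟨fun w => f (circleMk w.2), f.continuous.comp (continuous_circleMk.comp continuous_snd)⟩
      (hasFrame_const (f (circleMk 0)))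
    exact h1.comp (g := fun t : unitInterval => ((), t)) (by fun_prop)
  obtain ⟨X, hX, hXc⟩ := h
  obtain ⟨k, hk, hk'⟩ := exists_comparison (congrArg f circleMk_zero_eq_one) (hX 0) (hX 1)
  obtain ⟨c, hc0, hc1, hc, hcc⟩ := exists_path_injective k hk
  have h01 (v : F) : (⟨f (circleMk 0), X 0 (c 0 v)⟩ : TotalSpace F E)
      = ⟨f (circleMk 1), X 1 (c 1 v)⟩ := by
    rw [hc0, hc1, hk']
    rfl
  refine HasFrame.descend (g := circleMk) continuous_circleMk.isProperMap circleMk_surjective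
    (fun t => X t ∘ₗ c t) (fun t => (hX t).comp (hc t)) (hXc.comp (continuous_fst.prodMk hcc))
    fun s t hst v => ?_
  rcases eq_of_circleMk_eq hst with rfl | ⟨rfl, rfl⟩ | ⟨rfl, rfl⟩
  · rfl
  · exact h01 v
  · exact (h01 v).symm

end Homotopy

theorem continuous_glue : Continuous glue :=
  continuous_fst.prodMk ((AddCircle.continuous_mk' 1).comp
    (continuous_subtype_val.comp continuous_snd))

theorem hasFrame_glue (F : Type*) [NormedAddCommGroup F] [NormedSpace ℂ F] [FiniteDimensional ℂ F]
    (E : Torus → Type*) [∀ b, AddCommGroup (E b)] [∀ b, Module ℂ (E b)]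
    [∀ b, TopologicalSpace (E b)] [TopologicalSpace (TotalSpace F E)]
    [FiberBundle F E] [VectorBundle ℂ F E] : HasFrame F E glue :=
  HasFrame.of_homotopy ⟨glue, continuous_glue⟩
    (hasFrame_circle ⟨fun s => glue (s, 0), continuous_glue.comp (by fun_prop)⟩)

/-! ### Unitary frames -/

section Unitary

/-- The linear functional defined by a vector and an inner product. -/
def coreFunctional {V : Type*} [AddCommGroup V] [Module ℂ V] (c : InnerProductSpace.Core ℂ V)
    (x : V) : V →ₗ[ℂ] ℂ where
  toFun y := c.inner x y
  map_add' y z := by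
    rw [← c.conj_inner_symm, c.add_left, map_add, c.conj_inner_symm, c.conj_inner_symm]
  map_smul' r y := by
    rw [← c.conj_inner_symm, c.smul_left, map_mul, c.conj_inner_symm, Complex.conj_conj]
    rfl

variable {F : Type*} [NormedAddCommGroup F] [InnerProductSpace ℂ F] [FiniteDimensional ℂ F]

/-- The Gram operator of a frame. -/
def gram {V : Type*} [AddCommGroup V] [Module ℂ V] (c : InnerProductSpace.Core ℂ V)
    (X : F →ₗ[ℂ] V) : F →L[ℂ] F :=
  LinearMap.toContinuousLinearMap (∑ i, (coreFunctional c (X (stdOrthonormalBasis ℂ F i)) ∘ₗ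
    X).smulRight (stdOrthonormalBasis ℂ F i))

theorem gram_apply {V : Type*} [AddCommGroup V] [Module ℂ V] (c : InnerProductSpace.Core ℂ V)
    (X : F →ₗ[ℂ] V) (v : F) : gram c X v =
      ∑ i, c.inner (X (stdOrthonormalBasis ℂ F i)) (X v) • stdOrthonormalBasis ℂ F i := by
  simp [gram, coreFunctional]

theorem inner_gram {V : Type*} [AddCommGroup V] [Module ℂ V] (c : InnerProductSpace.Core ℂ V)
    (X : F →ₗ[ℂ] V) (u v : F) : inner ℂ u (gram c X v) = c.inner (X u) (X v) := by
  have h : c.inner (X v) (X u) = ∑ i, inner ℂ (stdOrthonormalBasis ℂ F i) u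
      * c.inner (X v) (X (stdOrthonormalBasis ℂ F i)) := by
    change (coreFunctional c (X v) ∘ₗ X) u = _
    conv_lhs => rw [← (stdOrthonormalBasis ℂ F).sum_repr' u]
    rw [map_sum]
    exact Finset.sum_congr rfl fun i _ => map_smul _ _ _
  rw [← c.conj_inner_symm, h, gram_apply, inner_sum, map_sum]
  refine Finset.sum_congr rfl fun i _ => ?_
  rw [inner_smul_right, map_mul, c.conj_inner_symm, inner_conj_symm, mul_comm]

theorem gram_isPositive {V : Type*} [AddCommGroup V] [Module ℂ V]
    (c : InnerProductSpace.Core ℂ V) (X : F →ₗ[ℂ] V) : (gram c X).IsPositive := by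
  have hsymm : ∀ u v, inner ℂ (gram c X u) v = inner ℂ u (gram c X v) := fun u v => by
    rw [inner_gram, ← inner_conj_symm, inner_gram, c.conj_inner_symm]
  refine ⟨hsymm, fun v => ?_⟩
  rw [ContinuousLinearMap.reApplyInnerSelf_apply, hsymm, inner_gram]
  exact c.re_inner_nonneg _

theorem spectrum_gram {V : Type*} [AddCommGroup V] [Module ℂ V] (c : InnerProductSpace.Core ℂ V)
    {X : F →ₗ[ℂ] V} (hX : Function.Injective X) : spectrum ℝ (gram c X) ⊆ Set.Ioi 0 := by
  have : CompleteSpace F := FiniteDimensional.complete ℂ F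
  intro r hr
  have h0 : 0 ≤ gram c X :=
    (ContinuousLinearMap.nonneg_iff_isPositive _).2 (gram_isPositive c X)
  refine lt_of_le_of_ne (spectrum_nonneg_of_nonneg h0 hr) ?_
  rintro rfl
  have hinj : Function.Injective (gram c X) := by
    refine (injective_iff_map_eq_zero _).2 fun v hv => ?_
    have h1 := inner_gram c X v v
    rw [hv, inner_zero_right] at h1
    exact (injective_iff_map_eq_zero _).1 hX v (c.definite _ h1.symm)
  have hunit : IsUnit (gram c X) := ContinuousLinearMap.isUnit_iff_bijective.2
    ⟨hinj, (LinearMap.injective_iff_surjective (f := (gram c X : F →ₗ[ℂ] F))).1 hinj⟩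
  exact spectrum.zero_notMem ℝ hunit hr

/-- If P is the Gram operator of a frame X, then X P^(-1/2) is unitary. It depends continuously on
the point because the spectrum of P stays in (0, ∞), where x ↦ x^(-1/2) is continuous. -/
theorem exists_unitary_frame {B : Type*} [TopologicalSpace B] {E : B → Type*}
    [∀ b, AddCommGroup (E b)] [∀ b, Module ℂ (E b)]
    [∀ b, TopologicalSpace (E b)] [TopologicalSpace (TotalSpace F E)]
    [FiberBundle F E] [VectorBundle ℂ F E] {W : Type*} [TopologicalSpace W] {f : W → B}
    (hf : HasFrame F E f) (h : HermitianMetric F E) :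
    ∃ X : ∀ w, F ≃ₗ[ℂ] E (f w), (∀ w u v, (h.form (f w)).inner (X w u) (X w v) = inner ℂ u v) ∧
      Continuous fun p : W × F => (⟨f p.1, X p.1 p.2⟩ : TotalSpace F E) := by
  have : CompleteSpace F := FiniteDimensional.complete ℂ F
  obtain ⟨X, hX, hXc⟩ := hf
  let P : W → F →L[ℂ] F := fun w => gram (h.form (f w)) (X w)
  have hP (w : W) : IsSelfAdjoint (P w) := (gram_isPositive _ _).isSelfAdjoint
  have hPc : Continuous P := by
    refine continuous_clm_apply.2 fun v => ?_
    simp only [P, gram_apply]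
    refine continuous_finsetSum _ fun i _ => Continuous.smul ?_ continuous_const
    exact h.continuous_inner (hXc.comp (f := fun w => (w, stdOrthonormalBasis ℂ F i)) (by fun_prop))
      (hXc.comp (f := fun w => (w, v)) (by fun_prop))
  have hspec (w : W) : spectrum ℝ (P w) ⊆ Set.Ioi 0 := spectrum_gram _ (hX w)
  let r : ℝ → ℝ := fun x => (√x)⁻¹
  have hr : ContinuousOn r (Set.Ioi 0) :=
    Real.continuous_sqrt.continuousOn.inv₀ fun x hx => (Real.sqrt_pos.2 hx).ne'
  let R : W → F →L[ℂ] F := fun w => cfc r (P w)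
  have hRc : Continuous R := Continuous.cfc_of_mem_nhdsSet r
    (isOpen_Ioi.mem_nhdsSet.2 (Set.iUnion_subset hspec)) hPc hP hr
  have hR (w : W) : IsSelfAdjoint (R w) := cfc_predicate r (P w)
  have hRPR (w : W) : R w * (P w * R w) = 1 := by
    have hrw := hr.mono (hspec w)
    have h1 : P w * R w = cfc (fun x => x * r x) (P w) := by
      rw [cfc_mul (fun x => x) r (P w) continuousOn_id hrw, cfc_id' ℝ (P w) (hP w)]
    rw [h1, ← cfc_mul r (fun x => x * r x) (P w) hrw (continuousOn_id.mul hrw),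
      ← cfc_const_one ℝ (P w) (hP w)]
    refine cfc_congr fun x hx => ?_
    have hx0 : 0 < x := hspec w hx
    have hs := (Real.sqrt_pos.2 hx0).ne'
    simp only [r]
    field_simp
    exact (Real.sq_sqrt hx0.le).symm
  have hinner (w : W) (u v : F) :
      (h.form (f w)).inner (X w (R w u)) (X w (R w v)) = inner ℂ u v := by
    rw [← inner_gram]
    have h1 : inner ℂ (R w u) (P w (R w v)) = inner ℂ u (R w (P w (R w v))) :=
      (ContinuousLinearMap.isSelfAdjoint_iff_isSymmetric.1 (hR w)) u _
    refine h1.trans ?_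
    change inner ℂ u ((R w * (P w * R w)) v) = _
    rw [hRPR]
    rfl
  have hinj (w : W) : Function.Injective (X w ∘ₗ (R w : F →ₗ[ℂ] F)) := by
    refine (hX w).comp ((injective_iff_map_eq_zero _).2 fun v hv => ?_)
    have h1 := congrArg (fun T : F →L[ℂ] F => T v) (hRPR w)
    have h2 : R w v = 0 := hv
    change R w (P w (R w v)) = v at h1
    rw [← h1, h2, map_zero, map_zero]
  refine ⟨fun w => LinearEquiv.ofBijective _ (bijective_of_injective (hinj w)), hinner, ?_⟩
  have hRc' : Continuous fun p : W × F => R p.1 p.2 :=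
    (hRc.comp continuous_fst).clm_apply continuous_snd
  exact hXc.comp (continuous_fst.prodMk hRc')

end Unitary

/-! ### The degree of a loop -/

theorem coe_period_int (a : ℤ) : ((a : ℝ) : UnitAddCircle) = 0 :=
  (AddCircle.coe_eq_zero_iff _).2 ⟨a, by simp⟩

theorem exists_hasDegree {f : UnitAddCircle → ℂ} (hf : Continuous f) (h : ∀ s, ‖f s‖ = 1) :
    ∃ n, HasDegree f n := by
  obtain ⟨l, hl⟩ := exists_log (A := ℝ) ⟨fun s => f (s : UnitAddCircle),
    hf.comp (AddCircle.continuous_mk' 1)⟩ fun s h0 => by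
      have := h (s : UnitAddCircle)
      rw [show f (s : UnitAddCircle) = 0 from h0, norm_zero] at this
      exact zero_ne_one this
  have hl (s : ℝ) : Complex.exp (l s) = f (s : UnitAddCircle) := hl s
  have hre (s : ℝ) : (l s).re = 0 := by
    have := h (s : UnitAddCircle)
    rwa [← hl, Complex.norm_exp, Real.exp_eq_one_iff] at this
  have hpi : (Real.pi : ℂ) ≠ 0 := by exact_mod_cast Real.pi_ne_zero
  have hθ (s : ℝ) : 2 * Real.pi * Complex.I * (((l s).im / (2 * Real.pi) : ℝ) : ℂ) = l s := by
    conv_rhs => rw [← Complex.re_add_im (l s), hre]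
    push_cast
    field_simp
    simp
  have h01 : Complex.exp (l 1) = Complex.exp (l 0) := by
    rw [hl, hl]
    congr 1
    simp
  obtain ⟨n, hn⟩ := Complex.exp_eq_exp_iff_exists_int.1 h01
  refine ⟨n, fun s => (l s).im / (2 * Real.pi), by fun_prop, fun s => ?_, ?_⟩
  · rw [hθ, hl]
  · have : Real.pi ≠ 0 := Real.pi_ne_zero
    change (l 1).im / (2 * Real.pi) - (l 0).im / (2 * Real.pi) = n
    rw [hn]
    simp
    field_simp
    ring

/-- The angle function of a loop of degree `n`. -/
theorem HasDegree.exists_angle {f : UnitAddCircle → ℂ} {n : ℤ} (h : HasDegree f n) :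
    ∃ θ : ℝ → ℝ, Continuous θ ∧
      (∀ s : ℝ, f (s : UnitAddCircle) = Complex.exp (2 * Real.pi * Complex.I * (θ s : ℂ))) ∧
      ∀ (s : ℝ) (a : ℤ), θ (s + a) = θ s + n * a := by
  obtain ⟨θ, hθ, hf, h1⟩ := h
  refine ⟨θ, hθ, hf, ?_⟩
  -- The degree fixes the increment of θ over a period only at s = 0. By continuity the increment is
  -- the same integer at every s.
  obtain ⟨k, hk⟩ := exists_int_of_exp_eq (A := ℝ)
    (f := fun s => 2 * Real.pi * Complex.I * (θ s : ℂ))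
    (g := fun s => 2 * Real.pi * Complex.I * (θ (s + 1) : ℂ)) (by fun_prop) (by fun_prop)
    fun s => by
      rw [← hf, ← hf]
      congr 1
      simp
  have hstep (s : ℝ) : θ (s + 1) = θ s + k := by
    have h2 : 2 * Real.pi * Complex.I * (θ (s + 1) : ℂ)
        = 2 * Real.pi * Complex.I * (θ s + k : ℂ) := (hk s).trans (by ring)
    exact_mod_cast mul_left_cancel₀ Complex.two_pi_I_ne_zero h2
  have hkn : (k : ℝ) = n := by
    have := hstep 0
    rw [zero_add] at this
    linarith
  intro s a
  induction a using Int.induction_on with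
  | zero => simp
  | succ a ih =>
    push_cast at ih ⊢
    rw [← add_assoc, hstep, ih, hkn]
    ring
  | pred a ih =>
    have := hstep (s + (-a - 1))
    push_cast at ih ⊢
    rw [show s + (-(a : ℝ) - 1) + 1 = s + -a by ring, ih, hkn] at this
    linarith

/-! ### Existence of the twist -/

section Twist

variable {q : ℕ} {E : Torus → Type*} [∀ x, AddCommGroup (E x)] [∀ x, Module ℂ (E x)]
  [∀ x, TopologicalSpace (E x)] [TopologicalSpace (TotalSpace (EuclideanSpace ℂ (Fin q)) E)]
  [FiberBundle (EuclideanSpace ℂ (Fin q)) E] [VectorBundle ℂ (EuclideanSpace ℂ (Fin q)) E]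

theorem glue_zero_eq_one (s : UnitAddCircle) : glue (s, 0) = glue (s, 1) :=
  congrArg (Prod.mk s) circleMk_zero_eq_one

/-- The comparison of the two frames over the seam preserves inner products. Its matrix entries are
the metric evaluated on Φ(s, 1)eᵢ and Φ(s, 0)eⱼ, hence continuous in s. -/
theorem exists_clutchingMap {h : HermitianMetric (EuclideanSpace ℂ (Fin q)) E}
    (Φ : CylinderTrivialization h) :
    ∃ g : C(UnitAddCircle, Matrix.unitaryGroup (Fin q) ℂ), IsClutchingMap Φ g := by
  choose k hk hk' using fun s : UnitAddCircle => exists_comparison (glue_zero_eq_one s)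
    (A := (Φ.toFun (s, 0)).toLinearMap) (Φ.toFun (s, 0)).injective
    (C := (Φ.toFun (s, 1)).toLinearMap) (Φ.toFun (s, 1)).injective
  let b := EuclideanSpace.basisFun (Fin q) ℂ
  have hinner (s : UnitAddCircle) (u v : EuclideanSpace ℂ (Fin q)) :
      inner ℂ (k s u) (k s v) = inner ℂ u v := by
    rw [← Φ.unitary (s, 1), ← Φ.unitary (s, 0)]
    exact h.inner_congr (hk' s u) (hk' s v)
  let M : UnitAddCircle → Matrix (Fin q) (Fin q) ℂ := fun s => Matrix.toEuclideanLin.symm (k s)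
  have hM (s : UnitAddCircle) (i j : Fin q) : M s i j = inner ℂ (b i) (k s (b j)) := by
    have h1 : k s = Matrix.toEuclideanLin (M s) := (LinearEquiv.apply_symm_apply _ _).symm
    rw [h1]
    simp [b, Matrix.toLpLin_apply, EuclideanSpace.inner_single_left]
  have hMc : Continuous M := by
    refine continuous_matrix fun i j => ?_
    rw [show (fun s => M s i j) = fun s => (h.form (glue (s, 1))).inner (Φ.toFun (s, 1) (b i))
      (Φ.toFun (s, 1) (k s (b j))) from
        funext fun s => (hM s i j).trans (Φ.unitary (s, 1) _ _).symm]
    refine h.continuous_inner (f := fun s => glue (s, 1))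
      (Φ.continuous_toFun.comp (f := fun s => ((s, 1), b i)) (by fun_prop)) ?_
    exact (Φ.continuous_toFun.comp (f := fun s => ((s, 0), b j)) (by fun_prop)).congr
      fun s => (hk' s (b j)).symm
  have hMu (s : UnitAddCircle) : M s ∈ Matrix.unitaryGroup (Fin q) ℂ := by
    rw [Matrix.mem_unitaryGroup_iff']
    ext i j
    have h1 := hinner s (b i) (b j)
    rw [← b.sum_inner_mul_inner] at h1
    rw [Matrix.mul_apply, Matrix.one_apply, ← b.inner_eq_ite, ← h1]
    refine Finset.sum_congr rfl fun l _ => ?_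
    rw [Matrix.star_apply, hM, hM, RCLike.star_def, inner_conj_symm]
  refine ⟨⟨fun s => ⟨M s, hMu s⟩, hMc.subtype_mk _⟩, fun s v => ?_⟩
  have h1 : Matrix.toEuclideanLin (M s) = k s := LinearEquiv.apply_symm_apply _ _
  change _ = (⟨glue (s, 1), Φ.toFun (s, 1) (Matrix.toEuclideanLin (M s) v)⟩ : TotalSpace _ E)
  rw [h1]
  exact (hk' s v).symm

theorem exists_isTwist (h : HermitianMetric (EuclideanSpace ℂ (Fin q)) E) :
    ∃ n : ℤ, IsTwist h n := by
  obtain ⟨X, hX, hXc⟩ := exists_unitary_frame (hasFrame_glue (EuclideanSpace ℂ (Fin q)) E) h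
  let Φ : CylinderTrivialization h := ⟨X, hX, hXc⟩
  obtain ⟨g, hg⟩ := exists_clutchingMap Φ
  obtain ⟨n, hn⟩ := exists_hasDegree (f := fun s => (g s).1.det)
    (Continuous.matrix_det (continuous_subtype_val.comp g.continuous)) fun s => by
      have := (Matrix.det_of_mem_unitary (g s).2)
      exact CStarRing.norm_of_mem_unitary this
  exact ⟨n, Φ, g, hg, hn⟩

end Twist

/-! ### The determinant line bundle -/

section Det

variable {B F : Type*} [TopologicalSpace B] [NormedAddCommGroup F] [NormedSpace ℂ F]
  {E : B → Type*} [∀ b, AddCommGroup (E b)] [∀ b, Module ℂ (E b)]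
  [∀ b, TopologicalSpace (E b)] [TopologicalSpace (TotalSpace F E)] [FiberBundle F E]
  [VectorBundle ℂ F E]

/-- The vector of the determinant line defined by a frame of a fibre. -/
def detVec {b : B} (A : F →ₗ[ℂ] E b) : (detCore F E).Fiber b :=
  (LinearMap.det ((trivializationAt F E b).linearMapAt ℂ b ∘ₗ A) : ℂ)

theorem detVec_comp {b : B} (A : F →ₗ[ℂ] E b) (k : F →ₗ[ℂ] F) :
    detVec (A ∘ₗ k) = LinearMap.det k • detVec A := by
  change LinearMap.det (((trivializationAt F E b).linearMapAt ℂ b ∘ₗ A) ∘ₗ k)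
    = LinearMap.det k * LinearMap.det ((trivializationAt F E b).linearMapAt ℂ b ∘ₗ A)
  rw [LinearMap.det_comp, mul_comm]

theorem detVec_congr {x y : B} {A : F →ₗ[ℂ] E x} {C : F →ₗ[ℂ] E y} (hxy : x = y)
    (h : ∀ v, (⟨x, A v⟩ : TotalSpace F E) = ⟨y, C v⟩) :
    (⟨x, detVec A⟩ : TotalSpace ℂ (detCore F E).Fiber) = ⟨y, detVec C⟩ := by
  subst hxy
  have : A = C := LinearMap.ext fun v => by simpa [TotalSpace.mk_inj] using h v
  rw [this]

variable [FiniteDimensional ℂ F]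

theorem detVec_ne_zero {b : B} {A : F →ₗ[ℂ] E b} (hA : Function.Injective A) :
    detVec A ≠ 0 := by
  let e := LinearEquiv.ofBijective A (bijective_of_injective hA)
  let e' := (trivializationAt F E b).linearEquivAt ℂ b
    (FiberBundle.mem_baseSet_trivializationAt F E b)
  have h : (trivializationAt F E b).linearMapAt ℂ b ∘ₗ A = (e.trans e').toLinearMap := by
    ext v
    change (trivializationAt F E b).linearMapAt ℂ b (A v) = e' (A v)
    rw [Bundle.Trivialization.linearMapAt_apply,
      if_pos (FiberBundle.mem_baseSet_trivializationAt F E b)]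
    rfl
  change LinearMap.det ((trivializationAt F E b).linearMapAt ℂ b ∘ₗ A) ≠ 0
  rw [h]
  exact (LinearEquiv.isUnit_det' _).ne_zero

/-- `detVec` uses the preferred chart at each point, which varies discontinuously. In a fixed chart
of the determinant line the coordinate change turns it into the determinant of the frame in a fixed
chart of E. -/
theorem continuous_detVec {W : Type*} [TopologicalSpace W] {f : W → B} {X : ∀ w, F →ₗ[ℂ] E (f w)}
    (hf : Continuous f)
    (hX : Continuous fun p : W × F => (⟨f p.1, X p.1 p.2⟩ : TotalSpace F E)) :
    Continuous fun w => (⟨f w, detVec (X w)⟩ : TotalSpace ℂ (detCore F E).Fiber) := by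
  have : CompleteSpace F := FiniteDimensional.complete ℂ F
  refine continuous_section_of_coord hf fun w => ?_
  let e := trivializationAt F E (f w)
  let M : W → F →L[ℂ] F := fun y => LinearMap.toContinuousLinearMap (e.linearMapAt ℂ (f y) ∘ₗ X y)
  have hgood : ∀ᶠ y in nhds w, f y ∈ e.baseSet := eventually_mem_baseSet hf w
  have hM : ContinuousAt M w := by
    refine continuousAt_clm_apply.2 fun v => ?_
    have h1 : Continuous fun y => (⟨f y, X y v⟩ : TotalSpace F E) :=
      hX.comp (f := fun y => (y, v)) (by fun_prop)
    refine (continuousAt_coord h1 (f w)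
      (FiberBundle.mem_baseSet_trivializationAt F E (f w))).congr ?_
    filter_upwards [hgood] with y hy
    change (e ⟨f y, X y v⟩).2 = e.linearMapAt ℂ (f y) (X y v)
    rw [Bundle.Trivialization.linearMapAt_apply, if_pos hy]
  refine (ContinuousLinearMap.continuous_det.continuousAt.comp hM).congr ?_
  filter_upwards [hgood] with y hy
  let e' := trivializationAt F E (f y)
  have hy' : f y ∈ e'.baseSet := FiberBundle.mem_baseSet_trivializationAt F E (f y)
  change LinearMap.det (e.linearMapAt ℂ (f y) ∘ₗ X y)
    = LinearMap.det ((e'.coordChangeL ℂ e (f y) : F →L[ℂ] F) : F →ₗ[ℂ] F)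
      * LinearMap.det (e'.linearMapAt ℂ (f y) ∘ₗ X y)
  rw [← LinearMap.det_comp]
  congr 1
  ext v
  change e.linearMapAt ℂ (f y) (X y v)
    = e'.coordChangeL ℂ e (f y) (e'.linearMapAt ℂ (f y) (X y v))
  rw [Bundle.Trivialization.coordChangeL_apply _ _ ⟨hy', hy⟩,
    Bundle.Trivialization.linearMapAt_apply, if_pos hy]
  have h1 := Bundle.Trivialization.symmₗ_linearMapAt (R := ℂ) e' hy' (X y v)
  rw [Bundle.Trivialization.symmₗ_apply _ hy'] at h1
  rw [h1]

end Det

/-! ### The determinant line of a bundle of twist n as a quotient of ℝ² × ℂ -/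

section DetFrame

variable {q : ℕ} {E : Torus → Type*} [∀ x, AddCommGroup (E x)] [∀ x, Module ℂ (E x)]
  [∀ x, TopologicalSpace (E x)] [TopologicalSpace (TotalSpace (EuclideanSpace ℂ (Fin q)) E)]
  [FiberBundle (EuclideanSpace ℂ (Fin q)) E] [VectorBundle ℂ (EuclideanSpace ℂ (Fin q)) E]

/-- Fibrewise scalar multiplication on the total space of a bundle. -/
def smulTotal {B F : Type*} {L : B → Type*} [∀ b, AddCommGroup (L b)] [∀ b, Module ℂ (L b)]
    (c : ℂ) (p : TotalSpace F L) : TotalSpace F L := ⟨p.1, c • p.2⟩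

theorem smulTotal_smulTotal {B F : Type*} {L : B → Type*} [∀ b, AddCommGroup (L b)]
    [∀ b, Module ℂ (L b)] (c d : ℂ) (p : TotalSpace F L) :
    smulTotal c (smulTotal d p) = smulTotal (c * d) p :=
  congrArg (TotalSpace.mk _) (mul_smul c d p.2).symm

/-- The determinant line bundle of a bundle of twist `n` is the quotient of `ℝ² × ℂ` by the
transformations `deck n a b`. -/
theorem exists_twistedFrame {h : HermitianMetric (EuclideanSpace ℂ (Fin q)) E} {n : ℤ}
    (hn : IsTwist h n) : Nonempty (TwistedFrame (detCore (EuclideanSpace ℂ (Fin q)) E).Fiber n) := by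
  obtain ⟨Φ, g, hg, hdeg⟩ := hn
  obtain ⟨θ, hθ, hdet, hper⟩ := hdeg.exists_angle
  let D : UnitAddCircle × unitInterval →
      TotalSpace ℂ (detCore (EuclideanSpace ℂ (Fin q)) E).Fiber :=
    fun z => ⟨glue z, detVec (Φ.toFun z).toLinearMap⟩
  have hD : Continuous D := continuous_detVec continuous_glue Φ.continuous_toFun
  have hD01 (s : ℝ) : D (s, 0)
      = smulTotal (Complex.exp (2 * Real.pi * Complex.I * (θ s : ℂ))) (D (s, 1)) := by
    rw [← hdet]
    have h1 := detVec_congr (A := (Φ.toFun (s, 0)).toLinearMap)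
      (C := (Φ.toFun (s, 1)).toLinearMap ∘ₗ Matrix.toEuclideanLin (g s).1)
      (glue_zero_eq_one s) (hg s)
    rw [detVec_comp, LinearMap.det_toLpLin] at h1
    exact h1
  -- The phase interpolates between 1 at t = 0 and det g(s) at t = 1, which is what clutching needs
  -- for the two ends to agree. The price is that G is no longer periodic in s.
  let G : ℝ → ℝ → TotalSpace ℂ (detCore (EuclideanSpace ℂ (Fin q)) E).Fiber := fun s t =>
    smulTotal (Complex.exp (2 * Real.pi * Complex.I * (t * θ s : ℂ)))
      (D (s, Set.projIcc 0 1 zero_le_one t))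
  have hG : Continuous (Function.uncurry G) := by
    refine continuous_smul_section (hD.comp (f := fun p : ℝ × ℝ =>
      ((p.1 : UnitAddCircle), Set.projIcc 0 1 zero_le_one p.2)) ?_) (by fun_prop)
    exact ((AddCircle.continuous_mk' 1).comp continuous_fst).prodMk
      (continuous_projIcc.comp continuous_snd)
  have hG01 (s : ℝ) : G s 0 = G s 1 := by
    have e0 : Set.projIcc (0 : ℝ) 1 zero_le_one 0 = 0 := Set.projIcc_left _
    have e1 : Set.projIcc (0 : ℝ) 1 zero_le_one 1 = 1 := Set.projIcc_right _
    simp only [G, e0, e1, hD01, Complex.ofReal_zero, zero_mul, mul_zero, Complex.exp_zero,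
      Complex.ofReal_one, one_mul]
    exact congrArg (TotalSpace.mk _) (one_smul ℂ _)
  have hGc : Continuous fun p : ℝ × ℝ => G p.1 (Int.fract p.2) :=
    hG.continuousOn.comp_fract' hG01
  have hproj (p : ℝ × ℝ) : torusMk p = (G p.1 (Int.fract p.2)).proj := by
    refine Prod.ext rfl ?_
    change (p.2 : UnitAddCircle) = ((Set.projIcc 0 1 zero_le_one (Int.fract p.2) : ℝ) : UnitAddCircle)
    rw [Set.projIcc_of_mem zero_le_one ⟨Int.fract_nonneg p.2, (Int.fract_lt_one p.2).le⟩,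
      AddCircle.coe_fract]
  have hvec (p : ℝ × ℝ) : ∃ v : (detCore (EuclideanSpace ℂ (Fin q)) E).Fiber (torusMk p),
      (⟨torusMk p, v⟩ : TotalSpace ℂ _) = G p.1 (Int.fract p.2) := by
    rw [hproj]
    exact ⟨_, rfl⟩
  choose vec hvec using hvec
  refine ⟨⟨vec, fun p hp => ?_, hGc.congr fun p => (hvec p).symm, fun a b x => ?_⟩⟩
  · have h0 : (G p.1 (Int.fract p.2)).2 = 0 := by
      rw [← hvec, hp]
    exact smul_ne_zero (Complex.exp_ne_zero _)
      (detVec_ne_zero (Φ.toFun _).injective) h0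
  · obtain ⟨⟨s, t⟩, v⟩ := x
    change smulTotal _ (⟨torusMk _, vec _⟩ : TotalSpace ℂ _)
      = smulTotal v (⟨torusMk (s, t), vec (s, t)⟩ : TotalSpace ℂ _)
    rw [hvec, hvec]
    have e1 : ((s + a : ℝ) : UnitAddCircle) = s := by
      rw [AddCircle.coe_add, coe_period_int, add_zero]
    change smulTotal _ (G (s + a) (Int.fract (t + b))) = smulTotal v (G s (Int.fract t))
    simp only [G]
    rw [Int.fract_add_intCast, e1, hper, smulTotal_smulTotal, smulTotal_smulTotal]
    congr 1
    rw [deck_apply]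
    dsimp only
    rw [mul_right_comm, ← Complex.exp_add, mul_comm]
    congr 1
    -- Since θ(s + a) = θ(s) + n a, the frame gains exp(2πi n a {t}) while `deck` contributes
    -- exp(-2πi n a t). The exponents differ by 2πi times this integer.
    refine Complex.exp_eq_exp_iff_exists_int.2 ⟨-(n * a * ⌊t⌋), ?_⟩
    rw [Int.fract]
    push_cast
    ring

end DetFrame

end TorusBundle

end

theorem mainTheorem3 (q : ℕ) (E : TorusBundle.Torus → Type*)
    [∀ x, AddCommGroup (E x)] [∀ x, Module ℂ (E x)] [∀ x, TopologicalSpace (E x)]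
    [TopologicalSpace (Bundle.TotalSpace (EuclideanSpace ℂ (Fin q)) E)]
    [FiberBundle (EuclideanSpace ℂ (Fin q)) E] [VectorBundle ℂ (EuclideanSpace ℂ (Fin q)) E] :
    Nonempty (TorusBundle.HermitianMetric (EuclideanSpace ℂ (Fin q)) E) ∧
    (∀ h : TorusBundle.HermitianMetric (EuclideanSpace ℂ (Fin q)) E,
      ∃ tw : ℤ, TorusBundle.IsTwist h tw) ∧
    (∃ c₁ : TorusBundle.Cohomology 1 TorusBundle.Torus,
      TorusBundle.IsFirstChernClass (EuclideanSpace ℂ (Fin q)) E c₁) ∧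
    ∀ (h : TorusBundle.HermitianMetric (EuclideanSpace ℂ (Fin q)) E) (tw : ℤ)
      (c₁ : TorusBundle.Cohomology 1 TorusBundle.Torus),
      TorusBundle.IsTwist h tw →
      TorusBundle.IsFirstChernClass (EuclideanSpace ℂ (Fin q)) E c₁ →
      tw = -TorusBundle.kronecker 1 TorusBundle.Torus c₁ TorusBundle.fundamentalClass := by
  obtain ⟨t, ⟨S⟩⟩ := TorusBundle.exists_splitting (EuclideanSpace ℂ (Fin q)) E
  have key (h : TorusBundle.HermitianMetric (EuclideanSpace ℂ (Fin q)) E) :=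
    TorusBundle.exists_isTwist h
  refine ⟨⟨S.metric⟩, key, ?_, fun h tw c₁ htw hc₁ => ?_⟩
  · obtain ⟨n, hn⟩ := key S.metric
    obtain ⟨fr⟩ := TorusBundle.exists_twistedFrame hn
    exact fr.exists_firstChernClass
  · obtain ⟨fr⟩ := TorusBundle.exists_twistedFrame htw
    rw [fr.kronecker_eq hc₁, neg_neg]
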